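/- Let $S\subset\mathbb{R}$ be a finite union of bounded intervals (each of which may be open, closed or half-open, and possibly degenerate). Then there exists a set $\Lambda\subset\mathbb{R}$ such that the system of exponentials $\{e^{i\lambda t}\}_{\lambda\in\Lambda}$ is a Riesz basis of $L^2(S)$ (the space of complex-valued functions that are square integrable on $S$ with respect to Lebesgue measure). Moreover, if $S\subseteq[0,2\pi]$, then $\Lambda$ may be chosen to satisfy $\Lambda\subseteq\mathbb{Z}$. Here a system of vectors in a Hilbert space $H$ is called a Riesz basis of $H$ if it is the image of an orthonormal basis of $H$ under a bounded invertible operator $H\to H$. If $S$ has measure zero, then $L^2(S)=\{0\}$, and the empty system counts as its orthonormal basis and as its Riesz basis. -/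

import Mathlib

/-- A system of vectors `f` in a complex Hilbert space `H` is a *Riesz basis* if it is the image of
an orthonormal (Hilbert) basis under a bounded invertible operator of `H`. -/
def IsRieszBasis {ι H : Type*} [NormedAddCommGroup H] [InnerProductSpace ℂ H]
    (f : ι → H) : Prop :=
  ∃ (b : HilbertBasis ι ℂ H) (T : H ≃L[ℂ] H), ∀ i, f i = T (b i)

/-- The exponentials `t ↦ e^{iλt}`, `λ ∈ Λ`, belong to `L²(S)` (complex valued, with respect to
Lebesgue measure on `S`), and the system of their classes, indexed by the set `Λ`, is a Riesz basis
of `L²(S)`. -/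
def IsExpRieszBasis (Λ S : Set ℝ) : Prop :=
  ∃ e : Λ → MeasureTheory.Lp ℂ 2 (MeasureTheory.volume.restrict S),
    (∀ l : Λ, e l =ᵐ[MeasureTheory.volume.restrict S]
      fun t : ℝ => Complex.exp (Complex.I * ((l : ℝ) : ℂ) * (t : ℂ))) ∧
    IsRieszBasis e

/-- `S` is the union of finitely many bounded intervals. Order-connected subsets of `ℝ` are exactly
the intervals: open, closed or half-open, one-point or empty. -/
def IsFiniteUnionOfIntervals (S : Set ℝ) : Prop :=
  ∃ (n : ℕ) (J : Fin n → Set ℝ),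
    (∀ i, (J i).OrdConnected ∧ Bornology.IsBounded (J i)) ∧ S = ⋃ i, J i

/-! After rescaling, S lies in one period and becomes, up to a null set, a finite union of arcs of
the circle ℝ/ℤ, and integer frequencies are sought. `IsRieszSpectrum Λ S` asks only that restriction
to S be a bijection from the L² functions with spectrum in Λ onto L²(S): the open mapping theorem
bounds the inverse, and polar decomposition (`isRieszBasis_of_equiv`) turns the isomorphism into a
Riesz basis.

Folding (`IsRieszSpectrum.combine`). Let A_n be the set of y for which more than n of the N
solutions of Nx = y lie in S. If Λ_n is a Riesz spectrum of A_n for each n < N, then the union of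
the NΛ_n + n is one of S. Indeed write f(x) = Σ e(nx) g_n(Nx), where e(x) = exp(2πix) and g_n has
spectrum in Λ_n. On the fibre over y the values of f form a Vandermonde system in the g_n(y). If m
fibre points lie in S, then y is outside A_n for n ≥ m, so these g_n(y) cannot be prescribed; the
other m unknowns satisfy a square Vandermonde system. Treating g_{N-1}, ..., g_0 in this order
yields existence and uniqueness.

Reducing jumps. The indicator of S is a step function with L upward and L downward unit jumps per
period. Folding moves a jump from a to Na, and the A_n are superlevel sets of the folded function. A
superlevel set needs fewer jumps unless the function takes just two consecutive values
(`IsFloorSum.superlevel`). For L ≥ 2 some fold reduces L (`IsFloorSum.exists_reducing_fold`): if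
twice the difference of an upward and a downward jump is an integer, N = 2 cancels them; otherwise,
two-valued folds for every N would, by Bessel at frequencies ±1, ±2 averaged over N, give 5 ≤ π²/2,
which is false.

One arc. Dirichlet approximation gives a fold leaving only the circle, the empty set and an arc of
length δ ≤ 1/4. On that arc the orthogonal frequencies k/δ can be rounded to integers, a
perturbation of norm at most πδ < 1 (`exists_isRieszSpectrum_arc`). -/

open MeasureTheory AddCircle Set Filter
open scoped ENNReal NNReal

/-! ### Sections and inverse branches on the circle -/

/-- The representative in `(a, a + 1]` of a point of the circle. -/
noncomputable def circleRep (a : ℝ) (y : UnitAddCircle) : ℝ := (equivIoc (1 : ℝ) a y : ℝ)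

theorem circleRep_mem (a : ℝ) (y : UnitAddCircle) : circleRep a y ∈ Ioc a (a + 1) :=
  (equivIoc (1 : ℝ) a y).2

@[simp] theorem coe_circleRep (a : ℝ) (y : UnitAddCircle) :
    ((circleRep a y : ℝ) : UnitAddCircle) = y :=
  (equivIoc (1 : ℝ) a).symm_apply_apply y

theorem circleRep_coe {a t : ℝ} (ht : t ∈ Ioc a (a + 1)) :
    circleRep a (t : UnitAddCircle) = t := by
  unfold circleRep
  rw [equivIoc_coe_eq ht]

theorem measurableEmbedding_circleRep (a : ℝ) : MeasurableEmbedding (circleRep a) :=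
  (MeasurableEmbedding.subtype_coe measurableSet_Ioc).comp
    (measurableEquivIoc (1 : ℝ) a).measurableEmbedding

theorem haar_eq_volume : (haarAddCircle : Measure UnitAddCircle) = volume := by
  rw [volume_eq_smul_haarAddCircle]; simp

theorem map_circleRep (a : ℝ) :
    Measure.map (circleRep a) haarAddCircle = volume.restrict (Ioc a (a + 1)) := by
  have h := (measurePreserving_equivIoc (1 : ℝ) (a := a)).map_eq
  rw [haar_eq_volume, show circleRep a = Subtype.val ∘ equivIoc (1 : ℝ) a from rfl,
    ← Measure.map_map measurable_subtype_coe
      (show Measurable (equivIoc (1 : ℝ) a) from (measurableEquivIoc (1 : ℝ) a).measurable), h,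
    (MeasurableEmbedding.subtype_coe measurableSet_Ioc).map_comap, Subtype.range_coe]

theorem ae_circleRep_iff (a : ℝ) {P : ℝ → Prop} :
    (∀ᵐ y ∂(haarAddCircle : Measure UnitAddCircle), P (circleRep a y)) ↔
      ∀ᵐ t : ℝ, t ∈ Ioc a (a + 1) → P t := by
  rw [← (measurableEmbedding_circleRep a).ae_map_iff, map_circleRep,
    ae_restrict_iff' measurableSet_Ioc]

theorem ae_circle_iff_Ioc (a : ℝ) {P : UnitAddCircle → Prop} :
    (∀ᵐ y ∂(haarAddCircle : Measure UnitAddCircle), P y) ↔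
      ∀ᵐ t : ℝ, t ∈ Ioc a (a + 1) → P t := by
  rw [← ae_circleRep_iff a (P := fun t => P t)]
  simp

theorem ae_circle_iff {P : UnitAddCircle → Prop} :
    (∀ᵐ y ∂(haarAddCircle : Measure UnitAddCircle), P y) ↔ ∀ᵐ t : ℝ, P t := by
  constructor
  · intro h
    have h' : ∀ᵐ t : ℝ, ∀ n : ℤ, t ∈ Ioc (n : ℝ) (n + 1) → P t :=
      ae_all_iff.2 fun n => (ae_circle_iff_Ioc n).1 h
    filter_upwards [h'] with t ht
    refine ht (⌈t⌉ - 1) ⟨?_, ?_⟩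
    · push_cast; linarith [Int.ceil_lt_add_one t]
    · push_cast; linarith [Int.le_ceil t]
  · intro h
    rw [ae_circle_iff_Ioc 0]
    filter_upwards [h] with t ht _ using ht

theorem ae_affine_iff {r : ℝ} (hr : r ≠ 0) (p : ℝ) {P : ℝ → Prop} :
    (∀ᵐ t : ℝ, P (p + r * t)) ↔ ∀ᵐ t : ℝ, P t := by
  have e : MeasurableEmbedding fun t : ℝ => p + r * t :=
    (measurableEmbedding_addLeft p).comp (measurableEmbedding_mulLeft₀ hr)
  rw [← e.ae_map_iff]
  have : Measure.map (fun t : ℝ => p + r * t) volume = ENNReal.ofReal |r⁻¹| • volume := by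
    rw [show (fun t : ℝ => p + r * t) = (fun t => p + t) ∘ (fun t => r * t) from rfl,
      ← Measure.map_map (measurable_const_add p) (measurable_const_mul r),
      Real.map_volume_mul_left hr, Measure.map_smul, map_add_left_eq_self]
  rw [this]
  simp only [ae_iff, Measure.smul_apply, smul_eq_mul, mul_eq_zero, ENNReal.ofReal_eq_zero,
    abs_nonpos_iff, inv_eq_zero, hr, false_or]

/-- The map `y ↦ p + r y` from the fundamental domain `(0, 1]` to the circle. -/
noncomputable def branch (p r : ℝ) (y : UnitAddCircle) : UnitAddCircle :=
  ((p + r * circleRep 0 y : ℝ) : UnitAddCircle)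

theorem measurable_branch (p r : ℝ) : Measurable (branch p r) :=
  AddCircle.measurable_mk'.comp
    (((measurableEmbedding_circleRep 0).measurable.const_mul r).const_add p)

theorem ae_branch_iff {r : ℝ} (hr : 0 < r) (p : ℝ) {P : UnitAddCircle → Prop} :
    (∀ᵐ y ∂(haarAddCircle : Measure UnitAddCircle), P (branch p r y)) ↔
      ∀ᵐ t : ℝ, t ∈ Ioc p (p + r) → P t := by
  rw [show (∀ᵐ y ∂(haarAddCircle : Measure UnitAddCircle), P (branch p r y)) ↔ _ from
    ae_circleRep_iff 0 (P := fun t => P ((p + r * t : ℝ) : UnitAddCircle)),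
    ← ae_affine_iff hr.ne' p (P := fun t => t ∈ Ioc p (p + r) → P t)]
  refine eventually_congr (Eventually.of_forall fun t => ?_)
  have : t ∈ Ioc (0 : ℝ) (0 + 1) ↔ p + r * t ∈ Ioc p (p + r) := by
    simp only [mem_Ioc, zero_add]
    constructor
    · rintro ⟨h1, h2⟩; constructor <;> nlinarith
    · rintro ⟨h1, h2⟩
      exact ⟨by by_contra h; nlinarith, by by_contra h; nlinarith⟩
  rw [this]

theorem ae_of_ae_branch {r : ℝ} (hr : 0 < r) (p : ℝ) {P : UnitAddCircle → Prop}
    (h : ∀ᵐ x ∂(haarAddCircle : Measure UnitAddCircle), P x) :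
    ∀ᵐ y ∂(haarAddCircle : Measure UnitAddCircle), P (branch p r y) := by
  rw [ae_branch_iff hr]
  filter_upwards [ae_circle_iff.1 h] with t ht _ using ht

/-- Rescaling an interval of length at most `P` to the circle of length `1`. -/
theorem map_scale_le {P c : ℝ} (hP : 0 < P) :
    Measure.map (fun t : ℝ => ((t / P : ℝ) : UnitAddCircle)) (volume.restrict (Ioc c (c + P))) ≤
      ENNReal.ofReal P • haarAddCircle := by
  have hm : Measurable (fun t : ℝ => ((t / P : ℝ) : UnitAddCircle)) :=
    AddCircle.measurable_mk'.comp (measurable_id.div_const P)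
  refine Measure.le_iff.2 fun A hA => ?_
  rw [Measure.map_apply hm hA, Measure.restrict_apply (hm hA), Measure.smul_apply,
    haar_eq_volume, add_projection_respects_measure (1 : ℝ) (c / P) hA]
  have : (fun t : ℝ => ((t / P : ℝ) : UnitAddCircle)) ⁻¹' A ∩ Ioc c (c + P) =
      (fun t => P⁻¹ * t) ⁻¹' (QuotientAddGroup.mk ⁻¹' A ∩ Ioc (c / P) (c / P + 1)) := by
    ext t
    simp only [mem_inter_iff, mem_preimage, mem_Ioc]
    have e : P⁻¹ * t = t / P := by ring
    rw [e, show c / P + 1 = (c + P) / P by field_simp, div_lt_div_iff_of_pos_right hP,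
      div_le_div_iff_of_pos_right hP]
  rw [this, Real.volume_preimage_mul_left (inv_ne_zero hP.ne'), inv_inv, abs_of_pos hP]
  rfl

/-- As r ≤ 1, the branch covers an arc of length r once, with density r⁻¹. This domination makes
composition with it bounded on L². -/
theorem map_branch_le {r : ℝ} (hr : 0 < r) (hr1 : r ≤ 1) (p : ℝ) :
    Measure.map (branch p r) haarAddCircle ≤ ENNReal.ofReal r⁻¹ • haarAddCircle := by
  have hm : Measurable (fun t : ℝ => ((p + r * t : ℝ) : UnitAddCircle)) :=
    AddCircle.measurable_mk'.comp ((measurable_id.const_mul r).const_add p)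
  refine Measure.le_iff.2 fun A hA => ?_
  rw [show branch p r = (fun t : ℝ => ((p + r * t : ℝ) : UnitAddCircle)) ∘ circleRep 0 from rfl,
    ← Measure.map_map hm (measurableEmbedding_circleRep 0).measurable, map_circleRep,
    Measure.map_apply hm hA, Measure.restrict_apply (hm hA), Measure.smul_apply,
    haar_eq_volume, add_projection_respects_measure (1 : ℝ) p hA]
  have : (fun t : ℝ => ((p + r * t : ℝ) : UnitAddCircle)) ⁻¹' A ∩ Ioc 0 (0 + 1) ⊆
      (fun t => r * t) ⁻¹' ((fun t => p + t) ⁻¹' (QuotientAddGroup.mk ⁻¹' A ∩ Ioc p (p + 1))) := by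
    rintro t ⟨h1, h2, h3⟩
    refine ⟨h1, ?_, ?_⟩
    · simp only; nlinarith
    · simp only; nlinarith
  refine (measure_mono this).trans ?_
  rw [Real.volume_preimage_mul_left hr.ne', measure_preimage_add, abs_of_pos (inv_pos.2 hr)]
  rfl

theorem memLp_comp_branch {r : ℝ} (hr : 0 < r) (hr1 : r ≤ 1) (p : ℝ) {g : UnitAddCircle → ℂ}
    (hg : MemLp g 2 haarAddCircle) : MemLp (fun y => g (branch p r y)) 2 haarAddCircle :=
  (hg.of_measure_le_smul ENNReal.ofReal_ne_top (map_branch_le hr hr1 p)).comp_of_map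
    (measurable_branch p r).aemeasurable

/-- Composition with a map whose image measure is dominated, as an operator between `L²` spaces. -/
theorem exists_compLp {X Y : Type*} [MeasurableSpace X] [MeasurableSpace Y] {μ : Measure X}
    {ν : Measure Y} {φ : X → Y} (hφ : Measurable φ) {C : ℝ≥0∞} (hC : C ≠ ∞)
    (h : Measure.map φ μ ≤ C • ν) :
    ∃ T : Lp ℂ 2 ν →L[ℂ] Lp ℂ 2 μ, ∀ g : Lp ℂ 2 ν, T g =ᵐ[μ] fun x => g (φ x) := by
  have hmem : ∀ g : Lp ℂ 2 ν, MemLp (fun x => g (φ x)) 2 μ := fun g =>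
    ((Lp.memLp g).of_measure_le_smul hC h).comp_of_map hφ.aemeasurable
  have hac : Measure.map φ μ ≪ ν :=
    (Measure.absolutelyContinuous_of_le h).trans Measure.smul_absolutelyContinuous
  have hq : Measure.QuasiMeasurePreserving φ μ ν := ⟨hφ, hac⟩
  let T : Lp ℂ 2 ν →ₗ[ℂ] Lp ℂ 2 μ :=
    { toFun := fun g => (hmem g).toLp
      map_add' := fun f g => by
        rw [← MemLp.toLp_add]
        refine MemLp.toLp_congr _ _ ?_
        filter_upwards [hq.ae (Lp.coeFn_add f g)] with x hx
        simpa using hx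
      map_smul' := fun c g => by
        rw [RingHom.id_apply, ← MemLp.toLp_const_smul]
        refine MemLp.toLp_congr _ _ ?_
        filter_upwards [hq.ae (Lp.coeFn_smul c g)] with x hx
        simpa using hx }
  refine ⟨T.mkContinuous (C ^ (1 / (2 : ℝ≥0∞)).toReal).toReal fun g => ?_, fun g =>
    (hmem g).coeFn_toLp⟩
  change ‖(hmem g).toLp‖ ≤ _
  rw [Lp.norm_toLp, Lp.norm_def, ← ENNReal.toReal_mul]
  have hC' : C ^ (1 / (2 : ℝ≥0∞)).toReal ≠ ∞ := ENNReal.rpow_ne_top_of_nonneg (by positivity) hC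
  refine ENNReal.toReal_mono (ENNReal.mul_ne_top hC' (Lp.memLp g).2.ne) ?_
  have e := eLpNorm_map_measure (p := 2) ((Lp.aestronglyMeasurable g).mono_ac hac) hφ.aemeasurable
  rw [show (fun x => g (φ x)) = g ∘ φ from rfl, ← e, ← smul_eq_mul,
    ← eLpNorm_smul_measure_of_ne_top (by simp)]
  exact eLpNorm_mono_measure _ h

/-! ### Square integrable functions on the circle with prescribed spectrum -/

/-- `g ∈ L²` and the Fourier coefficients of `g` vanish outside `Λ`. -/
def HasSpectrumIn (Λ : Set ℤ) (g : UnitAddCircle → ℂ) : Prop :=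
  MemLp g 2 haarAddCircle ∧ ∀ n ∉ Λ, fourierCoeff g n = 0

/-- Every function of `L²(S)` is the restriction of exactly one `L²` function with spectrum in
`Λ`. -/
def IsRieszSpectrum (Λ : Set ℤ) (S : Set UnitAddCircle) : Prop :=
  (∀ G : UnitAddCircle → ℂ, MemLp G 2 haarAddCircle →
    ∃ g, HasSpectrumIn Λ g ∧ ∀ᵐ x ∂haarAddCircle, x ∈ S → g x = G x) ∧
  ∀ g, HasSpectrumIn Λ g → (∀ᵐ x ∂haarAddCircle, x ∈ S → g x = 0) → g =ᵐ[haarAddCircle] 0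

theorem fourierCoeff_eq_repr {g : UnitAddCircle → ℂ} (hg : MemLp g 2 haarAddCircle) (n : ℤ) :
    fourierCoeff g n = fourierBasis.repr hg.toLp n := by
  rw [fourierBasis_repr]
  exact congrFun (fourierCoeff_congr_ae hg.coeFn_toLp.symm) n

theorem ae_eq_of_fourierCoeff_eq {f g : UnitAddCircle → ℂ} (hf : MemLp f 2 haarAddCircle)
    (hg : MemLp g 2 haarAddCircle) (h : ∀ n, fourierCoeff f n = fourierCoeff g n) :
    f =ᵐ[haarAddCircle] g := by
  rw [← MemLp.toLp_eq_toLp_iff hf hg]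
  refine fourierBasis.repr.injective (lp.ext (funext fun n => ?_))
  rw [← fourierCoeff_eq_repr, ← fourierCoeff_eq_repr, h]

theorem exists_fourierCoeff_eq (a : ℤ → ℂ) (ha : Summable fun n => ‖a n‖ ^ 2) :
    ∃ g : UnitAddCircle → ℂ, MemLp g 2 haarAddCircle ∧ ∀ n, fourierCoeff g n = a n := by
  have hm : Memℓp a 2 := memℓp_gen (by simpa using ha)
  refine ⟨fourierBasis.repr.symm ⟨a, hm⟩, Lp.memLp _, fun n => ?_⟩
  rw [← fourierBasis_repr]
  simp

theorem summable_sq_fourierCoeff {g : UnitAddCircle → ℂ} (hg : MemLp g 2 haarAddCircle) :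
    Summable fun n => ‖fourierCoeff g n‖ ^ 2 := by
  have h := (lp.memℓp (fourierBasis.repr hg.toLp)).summable (by norm_num)
  simp_rw [fourierCoeff_eq_repr hg]
  simpa using h

theorem isRieszSpectrum_univ : IsRieszSpectrum univ univ :=
  ⟨fun G hG => ⟨G, ⟨hG, by simp⟩, by simp⟩, fun g _ h => h.mono fun x hx => hx (mem_univ x)⟩

theorem isRieszSpectrum_empty : IsRieszSpectrum ∅ ∅ := by
  refine ⟨fun G _ => ⟨0, ⟨MemLp.zero, fun n _ => by simp [fourierCoeff]⟩, by simp⟩,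
    fun g hg _ => ae_eq_of_fourierCoeff_eq hg.1 MemLp.zero fun n => ?_⟩
  rw [hg.2 n (by simp)]
  simp [fourierCoeff]

theorem norm_fourier_apply (n : ℤ) (x : UnitAddCircle) : ‖fourier n x‖ = 1 := by
  rw [fourier_apply, Circle.norm_coe]

theorem memLp_mul_of_norm_le_one {a g : UnitAddCircle → ℂ} (ha : Measurable a)
    (ha1 : ∀ x, ‖a x‖ ≤ 1) (hg : MemLp g 2 haarAddCircle) :
    MemLp (fun x => a x * g x) 2 haarAddCircle := by
  refine hg.of_le (ha.aestronglyMeasurable.mul hg.1) (Eventually.of_forall fun x => ?_)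
  rw [norm_mul]
  exact mul_le_of_le_one_left (norm_nonneg _) (ha1 x)

theorem memLp_fourier_mul {g : UnitAddCircle → ℂ} (hg : MemLp g 2 haarAddCircle)
    (n : ℤ) : MemLp (fun x => fourier n x * g x) 2 haarAddCircle :=
  memLp_mul_of_norm_le_one (map_continuous (fourier n)).measurable
    (fun x => (norm_fourier_apply n x).le) hg

/-! ### Dilations -/

theorem measurePreserving_nsmul_circle {N : ℕ} (hN : 0 < N) :
    MeasurePreserving (fun x : UnitAddCircle => N • x) haarAddCircle haarAddCircle := by
  rw [haar_eq_volume]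
  rcases Nat.lt_or_ge 1 N with h | h
  · exact (ergodic_nsmul h).toMeasurePreserving
  · obtain rfl : N = 1 := by omega
    simp only [one_smul]
    exact MeasurePreserving.id _

theorem memLp_dilation {N : ℕ} (hN : 0 < N) (n : ℤ) {g : UnitAddCircle → ℂ}
    (hg : MemLp g 2 haarAddCircle) :
    MemLp (fun x : UnitAddCircle => fourier n x * g (N • x)) 2 haarAddCircle :=
  memLp_fourier_mul (hg.comp_measurePreserving (measurePreserving_nsmul_circle hN)) n

theorem fourierCoeff_dilation {N : ℕ} (hN : 0 < N) (n k : ℤ) {g : UnitAddCircle → ℂ}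
    (hg : MemLp g 2 haarAddCircle) :
    fourierCoeff (fun x : UnitAddCircle => fourier n x * g (N • x)) (N * k + n) =
      fourierCoeff g k := by
  have hmp := measurePreserving_nsmul_circle hN
  have hae : AEStronglyMeasurable (fun y => fourier (-k) y • g y)
      (Measure.map (fun x : UnitAddCircle => N • x) haarAddCircle) := by
    rw [hmp.map_eq]
    exact (map_continuous (fourier (-k))).aestronglyMeasurable.smul hg.1
  have h := integral_map hmp.measurable.aemeasurable hae
  rw [hmp.map_eq] at h
  rw [fourierCoeff, fourierCoeff, h]
  refine integral_congr_ae (Eventually.of_forall fun x => ?_)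
  simp only [smul_eq_mul]
  rw [← mul_assoc, ← fourier_add]
  congr 1
  rw [fourier_apply, fourier_apply]
  congr 2
  rw [← natCast_zsmul x N, smul_smul]
  congr 1
  ring

/-- Translation by 1/N fixes g(N • x) and multiplies the integrand by a character value different
from 1, so the integral is a nontrivial multiple of itself. -/
theorem fourierCoeff_dilation_eq_zero {N : ℕ} (hN : 0 < N) (n m : ℤ) (h : ∀ k : ℤ, m ≠ N * k + n)
    (g : UnitAddCircle → ℂ) :
    fourierCoeff (fun x : UnitAddCircle => fourier n x * g (N • x)) m = 0 := by
  set F : UnitAddCircle → ℂ := fun x => fourier (-m) x • (fourier n x * g (N • x))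
  have hN' : (N : ℝ) ≠ 0 := by positivity
  have htr := integral_add_right_eq_self (μ := (haarAddCircle : Measure UnitAddCircle)) F
    ((1 / N : ℝ) : UnitAddCircle)
  have hz : N • ((1 / N : ℝ) : UnitAddCircle) = 0 := by
    rw [← AddCircle.coe_nsmul, nsmul_eq_mul, mul_one_div_cancel hN']
    exact AddCircle.coe_period 1
  have hF : ∀ x, F (x + ((1 / N : ℝ) : UnitAddCircle)) =
      fourier (n - m) ((1 / N : ℝ) : UnitAddCircle) * F x := by
    intro x
    have hadd : ∀ (j : ℤ) (y z : UnitAddCircle), fourier j (y + z) = fourier j y * fourier j z := by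
      intro j y z
      simp [fourier_apply, smul_add, toCircle_add]
    simp only [F, smul_eq_mul, smul_add, hz, add_zero]
    rw [hadd, hadd, show n - m = -m + n by ring, fourier_add]
    ring
  simp_rw [hF, integral_const_mul] at htr
  have hne : fourier (n - m) ((1 / N : ℝ) : UnitAddCircle) ≠ (1 : ℂ) := by
    rw [fourier_coe_apply, Ne, Complex.exp_eq_one_iff]
    rintro ⟨k, hk⟩
    have h2 : (2 * Real.pi * Complex.I : ℂ) ≠ 0 := Complex.two_pi_I_ne_zero
    have hNc : (N : ℂ) ≠ 0 := by exact_mod_cast hN.ne'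
    have h3 : ((n - m : ℤ) : ℂ) = k * N := by
      apply mul_left_cancel₀ h2
      push_cast at hk ⊢
      field_simp at hk
      linear_combination (2 * Real.pi * Complex.I) * hk
    have h4 : n - m = k * N := by exact_mod_cast h3
    exact h (-k) (by linarith)
  change ∫ x, F x ∂haarAddCircle = 0
  by_contra h0
  exact hne (mul_right_cancel₀ h0 (by rw [htr, one_mul]))

theorem memLp_sum_dilation {N : ℕ} (hN : 0 < N) {g : ℕ → UnitAddCircle → ℂ}
    (hg : ∀ n < N, MemLp (g n) 2 haarAddCircle) :
    MemLp (fun x : UnitAddCircle => ∑ n ∈ Finset.range N, fourier (n : ℤ) x * g n (N • x)) 2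
      haarAddCircle :=
  memLp_finsetSum _ fun n hn => memLp_dilation hN n (hg n (Finset.mem_range.1 hn))

theorem fourierCoeff_sum_dilation {N : ℕ} (hN : 0 < N) {g : ℕ → UnitAddCircle → ℂ}
    (hg : ∀ n < N, MemLp (g n) 2 haarAddCircle) {n : ℕ} (hn : n < N) (k : ℤ) :
    fourierCoeff (fun x : UnitAddCircle => ∑ n ∈ Finset.range N, fourier (n : ℤ) x * g n (N • x))
      (N * k + n) = fourierCoeff (g n) k := by
  have e := fourierCoeff.sum (Finset.range N)
    (fun n (x : UnitAddCircle) => fourier (n : ℤ) x * g n (N • x))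
    (fun i hi => (memLp_dilation hN i (hg i (Finset.mem_range.1 hi))).integrable (by norm_num))
  have e' := congrFun e (N * k + n)
  simp only [Finset.sum_apply] at e'
  have e2 : (∑ n ∈ Finset.range N, fun x : UnitAddCircle => fourier (n : ℤ) x * g n (N • x)) =
      fun x : UnitAddCircle => ∑ n ∈ Finset.range N, fourier (n : ℤ) x * g n (N • x) := by
    ext x; simp
  rw [e2] at e'
  rw [e', Finset.sum_eq_single n]
  · exact fourierCoeff_dilation hN n k (hg n hn)
  · intro i hi hin
    refine fourierCoeff_dilation_eq_zero hN _ _ (fun l hl => hin ?_) _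
    have hi' := Finset.mem_range.1 hi
    have h1 : ((n : ℤ) + N * k) % N = (i + N * l) % N := by rw [add_comm, hl, add_comm]
    rw [Int.add_mul_emod_self_left, Int.add_mul_emod_self_left,
      Int.emod_eq_of_lt (by positivity) (by exact_mod_cast hn),
      Int.emod_eq_of_lt (by positivity) (by exact_mod_cast hi')] at h1
    exact_mod_cast h1.symm
  · intro h
    exact absurd (Finset.mem_range.2 hn) h

theorem exists_residue {N : ℕ} (hN : 0 < N) (m : ℤ) : ∃ n < N, ∃ k : ℤ, m = N * k + n := by
  have hN' : (0 : ℤ) < N := by exact_mod_cast hN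
  refine ⟨(m % N).toNat, ?_, m / N, ?_⟩
  · have := Int.emod_lt_of_pos m hN'
    have := Int.emod_nonneg m hN'.ne'
    omega
  · rw [Int.toNat_of_nonneg (Int.emod_nonneg m hN'.ne')]
    exact (Int.mul_ediv_add_emod m N).symm

/-- Sort the Fourier coefficients of h by residue modulo N; each class is square summable and
defines one g_n. -/
theorem exists_eq_sum_dilation {N : ℕ} (hN : 0 < N) {h : UnitAddCircle → ℂ}
    (hh : MemLp h 2 haarAddCircle) :
    ∃ g : ℕ → UnitAddCircle → ℂ, (∀ n < N, MemLp (g n) 2 haarAddCircle) ∧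
      (∀ n < N, ∀ k : ℤ, fourierCoeff (g n) k = fourierCoeff h (N * k + n)) ∧
      h =ᵐ[haarAddCircle] fun x => ∑ n ∈ Finset.range N, fourier (n : ℤ) x * g n (N • x) := by
  have hN' : (N : ℤ) ≠ 0 := by exact_mod_cast hN.ne'
  have hs : ∀ n : ℕ, Summable fun k : ℤ => ‖fourierCoeff h (N * k + n)‖ ^ 2 := fun n =>
    (summable_sq_fourierCoeff hh).comp_injective (i := fun k : ℤ => N * k + n) fun a b hab =>
      mul_left_cancel₀ hN' (add_right_cancel hab)
  choose g hg hgc using fun n : ℕ => exists_fourierCoeff_eq _ (hs n)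
  refine ⟨g, fun n _ => hg n, fun n _ => hgc n,
    ae_eq_of_fourierCoeff_eq hh (memLp_sum_dilation hN fun n _ => hg n) fun m => ?_⟩
  obtain ⟨n, hn, k, rfl⟩ := exists_residue hN m
  rw [fourierCoeff_sum_dilation hN (fun n _ => hg n) hn, hgc]

/-! ### Combining spectra along the fibres of multiplication by `N` -/

/-- Take the k-th coefficient of the Lagrange interpolant: for n ≤ k < card J, X^n is its own
interpolant. This isolates the top unknown of a solvable, possibly overdetermined, Vandermonde
system. -/
theorem exists_vandermonde_functional {v : ℕ → ℂ} {J : Finset ℕ} (hv : Set.InjOn v J) {k : ℕ}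
    (hk : k < J.card) :
    ∃ c : ℕ → ℂ, ∀ n ≤ k, ∑ j ∈ J, c j * v j ^ n = if n = k then 1 else 0 := by
  refine ⟨fun j => (Lagrange.basis J v j).coeff k, fun n hn => ?_⟩
  have h : (Polynomial.X ^ n : Polynomial ℂ) = Lagrange.interpolate J v fun j => v j ^ n := by
    refine Lagrange.eq_interpolate_of_eval_eq _ hv ?_ (by simp)
    rw [Polynomial.degree_X_pow]
    exact_mod_cast hn.trans_lt hk
  have h' := congrArg (fun p => Polynomial.coeff p k) h
  simp only [Lagrange.interpolate_apply, Polynomial.finsetSum_coeff, Polynomial.coeff_C_mul,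
    Polynomial.coeff_X_pow] at h'
  simp_rw [mul_comm _ (v _ ^ n), ← h', eq_comm]

theorem exists_vandermonde_solution {v : ℕ → ℂ} {J : Finset ℕ} (hv : Set.InjOn v J)
    (r : ℕ → ℂ) :
    ∃ z : ℕ → ℂ, ∀ j ∈ J, ∑ n ∈ Finset.range J.card, v j ^ n * z n = r j := by
  refine ⟨(Lagrange.interpolate J v r).coeff, fun j hj => ?_⟩
  rw [← Lagrange.eval_interpolate_at_node r hv hj,
    Polynomial.eval_eq_sum_range' (n := J.card)]
  · simp_rw [mul_comm]
  · rcases eq_or_ne (Lagrange.interpolate J v r) 0 with h0 | h0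
    · rw [h0, Polynomial.natDegree_zero]
      exact Finset.card_pos.2 ⟨j, hj⟩
    · exact (Polynomial.natDegree_lt_iff_degree_lt h0).2 (Lagrange.degree_interpolate_lt r hv)

/-- The `j`-th point of the fibre of multiplication by `N` over `y`. -/
noncomputable def fibrePt (N j : ℕ) (y : UnitAddCircle) : UnitAddCircle :=
  branch ((j : ℝ) / N) ((N : ℝ)⁻¹) y

open Classical in
/-- The indices of the points of the fibre over `y` which lie in `S`. -/
noncomputable def fibreIdx (N : ℕ) (S : Set UnitAddCircle) (y : UnitAddCircle) : Finset ℕ :=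
  (Finset.range N).filter fun j => fibrePt N j y ∈ S

theorem mem_fibreIdx {N : ℕ} {S : Set UnitAddCircle} {y : UnitAddCircle} {j : ℕ} :
    j ∈ fibreIdx N S y ↔ j < N ∧ fibrePt N j y ∈ S := by
  simp [fibreIdx]

theorem fibreIdx_subset (N : ℕ) (S : Set UnitAddCircle) (y : UnitAddCircle) :
    fibreIdx N S y ⊆ Finset.range N := fun _ hj => Finset.mem_range.2 (mem_fibreIdx.1 hj).1

theorem card_fibreIdx_le (N : ℕ) (S : Set UnitAddCircle) (y : UnitAddCircle) :
    (fibreIdx N S y).card ≤ N := by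
  simpa using Finset.card_le_card (fibreIdx_subset N S y)

theorem measurableSet_fibreIdx_eq (N : ℕ) {S : Set UnitAddCircle} (hS : MeasurableSet S)
    (J : Finset ℕ) : MeasurableSet {y | fibreIdx N S y = J} := by
  have : {y | fibreIdx N S y = J} =
      ⋂ j : ℕ, {y | (j < N ∧ fibrePt N j y ∈ S) ↔ j ∈ J} := by
    ext y
    simp only [mem_ofPred_eq, mem_iInter, Finset.ext_iff, mem_fibreIdx]
  rw [this]
  refine MeasurableSet.iInter fun j => ?_
  have h1 : MeasurableSet {y | j < N ∧ fibrePt N j y ∈ S} :=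
    (MeasurableSet.const _).inter (measurable_branch _ _ hS)
  exact (h1.iff (MeasurableSet.const _))

theorem nsmul_fibrePt {N : ℕ} (hN : 0 < N) (j : ℕ) (y : UnitAddCircle) :
    N • fibrePt N j y = y := by
  have hN' : (N : ℝ) ≠ 0 := by positivity
  rw [fibrePt, branch, ← AddCircle.coe_nsmul, nsmul_eq_mul, mul_add, mul_div_cancel₀ _ hN',
    mul_inv_cancel_left₀ hN', AddCircle.coe_add, coe_circleRep]
  have : ((j : ℝ) : UnitAddCircle) = 0 := by
    have := AddCircle.coe_nsmul (p := (1 : ℝ)) (n := j) (x := 1)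
    rw [AddCircle.coe_period, nsmul_zero, nsmul_eq_mul, mul_one] at this
    exact this
  rw [this, zero_add]

/-- On a fibre the character splits into a phase independent of j, to be absorbed in the unknowns,
and a power of the Vandermonde node ω^j. -/
theorem fourier_fibrePt (N j n : ℕ) (y : UnitAddCircle) :
    fourier (n : ℤ) (fibrePt N j y) =
      Complex.exp (2 * Real.pi * Complex.I / N * circleRep 0 y * n) *
        (Complex.exp (2 * Real.pi * Complex.I / N) ^ j) ^ n := by
  rw [fibrePt, branch, fourier_coe_apply, ← pow_mul, ← Complex.exp_nat_mul, ← Complex.exp_add]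
  congr 1
  push_cast
  ring

theorem injOn_rootOfUnity_pow (N : ℕ) (hN : 0 < N) (S : Set UnitAddCircle) (y : UnitAddCircle) :
    Set.InjOn (fun j => Complex.exp (2 * Real.pi * Complex.I / N) ^ j) (fibreIdx N S y) := by
  intro i hi j hj hij
  exact (Complex.isPrimitiveRoot_exp N hN.ne').pow_inj (mem_fibreIdx.1 hi).1 (mem_fibreIdx.1 hj).1
    hij

theorem ae_forall_fibrePt {N : ℕ} (hN : 0 < N) {P : UnitAddCircle → Prop}
    (h : ∀ᵐ x ∂haarAddCircle, P x) : ∀ᵐ y ∂haarAddCircle, ∀ j : ℕ, P (fibrePt N j y) :=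
  ae_all_iff.2 fun _ => ae_of_ae_branch (by positivity) _ h

theorem ae_of_ae_fibrePt {N : ℕ} (hN : 0 < N) {P : UnitAddCircle → Prop}
    (h : ∀ᵐ y ∂haarAddCircle, ∀ j < N, P (fibrePt N j y)) : ∀ᵐ x ∂haarAddCircle, P x := by
  have hN' : (0 : ℝ) < N := by positivity
  have h' : ∀ᵐ t : ℝ, ∀ j : ℕ, j < N →
      t ∈ Ioc ((j : ℝ) / N) ((j : ℝ) / N + (N : ℝ)⁻¹) → P t := by
    refine ae_all_iff.2 fun j => ?_
    by_cases hj : j < N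
    · have := (ae_branch_iff (inv_pos.2 hN') ((j : ℝ) / N) (P := P)).1 (h.mono fun y hy => hy j hj)
      filter_upwards [this] with t ht _ using ht
    · exact Eventually.of_forall fun t hj' => absurd hj' hj
  rw [ae_circle_iff_Ioc 0]
  filter_upwards [h'] with t ht h01
  rw [zero_add] at h01
  have hc : 0 < ⌈N * t⌉ := Int.ceil_pos.2 (mul_pos hN' h01.1)
  have hc' : ⌈N * t⌉ ≤ N := by
    rw [Int.ceil_le]
    push_cast
    nlinarith [h01.2]
  have hcast : (((⌈N * t⌉ - 1).toNat : ℕ) : ℝ) = (⌈N * t⌉ : ℝ) - 1 := by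
    have : (((⌈N * t⌉ - 1).toNat : ℕ) : ℤ) = ⌈N * t⌉ - 1 := Int.toNat_of_nonneg (by omega)
    exact_mod_cast this
  -- The arcs (j/N, (j+1)/N] are closed on the right, so the one containing t has index ⌈Nt⌉ - 1.
  refine ht (⌈N * t⌉ - 1).toNat (by omega) ?_
  rw [hcast, mem_Ioc, div_lt_iff₀ hN', ← one_div, ← add_div, le_div_iff₀ hN']
  constructor
  · linarith [Int.ceil_lt_add_one (N * t)]
  · linarith [Int.le_ceil (N * t)]

/-- Invariant of the descending construction: once g_n is chosen for n ≥ k, the equations on the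
fibre are solvable in k remaining unknowns wherever at least k fibre points lie in S. At k = 0
nothing remains to solve. The z_n include the phases and need not be measurable in y. -/
theorem exists_fibre_system {N : ℕ} (hN : 0 < N) {S : Set UnitAddCircle} (hS : MeasurableSet S)
    {Λ : ℕ → Set ℤ} (h : ∀ n < N, IsRieszSpectrum (Λ n) {y | n < (fibreIdx N S y).card})
    {G : UnitAddCircle → ℂ} (hG : MemLp G 2 haarAddCircle) {k : ℕ} (hk : k ≤ N) :
    ∃ g : ℕ → UnitAddCircle → ℂ, (∀ n, k ≤ n → n < N → HasSpectrumIn (Λ n) (g n)) ∧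
      ∀ᵐ y ∂haarAddCircle, k ≤ (fibreIdx N S y).card → ∃ z : ℕ → ℂ, ∀ j ∈ fibreIdx N S y,
        ∑ n ∈ Finset.range k, (Complex.exp (2 * Real.pi * Complex.I / N) ^ j) ^ n * z n +
          ∑ n ∈ Finset.Ico k N, fourier (n : ℤ) (fibrePt N j y) * g n y = G (fibrePt N j y) := by
  set ω : ℂ := Complex.exp (2 * Real.pi * Complex.I / N) with hω
  induction hk using Nat.decreasingInduction with
  | self =>
    refine ⟨fun _ _ => 0, fun n h1 h2 => by omega, Eventually.of_forall fun y hy => ?_⟩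
    obtain ⟨z, hz⟩ := exists_vandermonde_solution (injOn_rootOfUnity_pow N hN S y)
      fun j => G (fibrePt N j y)
    have hc : (fibreIdx N S y).card = N := le_antisymm (card_fibreIdx_le N S y) hy
    rw [hc] at hz
    exact ⟨z, fun j hj => by simpa using hz j hj⟩
  | of_succ k hk ih =>
    obtain ⟨g, hg, hae⟩ := ih
    -- The functional extracting z_k is chosen once for each index set J, of which finitely many
    -- occur, so that w below is measurable. Irrelevant J get the default 0.
    have hc : ∀ J : Finset ℕ, ∃ c : ℕ → ℂ, (∃ y, fibreIdx N S y = J) → k < J.card → ∀ n ≤ k,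
        ∑ j ∈ J, c j * (ω ^ j) ^ n = if n = k then 1 else 0 := by
      intro J
      by_cases hJ : (∃ y, fibreIdx N S y = J) ∧ k < J.card
      · obtain ⟨⟨y, rfl⟩, hkJ⟩ := hJ
        obtain ⟨c, hc⟩ := exists_vandermonde_functional (injOn_rootOfUnity_pow N hN S y) hkJ
        exact ⟨c, fun _ _ => hc⟩
      · exact ⟨0, fun h1 h2 => absurd ⟨h1, h2⟩ hJ⟩
    choose c hc using hc
    let E : UnitAddCircle → ℂ := fun y =>
      Complex.exp (2 * Real.pi * Complex.I / N * circleRep 0 y * k)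
    have hE0 : ∀ y, E y ≠ 0 := fun y => Complex.exp_ne_zero _
    have hEm : Measurable E := by
      have := (measurableEmbedding_circleRep 0).measurable
      fun_prop
    have hE1 : ∀ y, ‖(E y)⁻¹‖ ≤ 1 := by
      intro y
      have : E y = Complex.exp ((2 * Real.pi / N * circleRep 0 y * k : ℝ) * Complex.I) := by
        simp only [E]; congr 1; push_cast; ring
      rw [norm_inv, this, Complex.norm_exp_ofReal_mul_I, inv_one]
    let r : ℕ → UnitAddCircle → ℂ := fun j y => G (fibrePt N j y) -
      ∑ n ∈ Finset.Ico (k + 1) N, fourier (n : ℤ) (fibrePt N j y) * g n y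
    have hr : ∀ j, MemLp (r j) 2 haarAddCircle := by
      intro j
      have hN1 : ((N : ℝ)⁻¹) ≤ 1 := inv_le_one_of_one_le₀ (by exact_mod_cast hN)
      refine (memLp_comp_branch (by positivity) hN1 _ hG).sub (memLp_finsetSum _ fun n hn => ?_)
      rw [Finset.mem_Ico] at hn
      exact memLp_mul_of_norm_le_one
        ((map_continuous (fourier (n : ℤ))).measurable.comp (measurable_branch _ _))
        (fun x => (norm_fourier_apply _ _).le) (hg n hn.1 hn.2).1
    -- The value forced on g_k where more than k fibre points lie in S: the functional applied to
    -- the residual r, with the phase E divided out.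
    let w : UnitAddCircle → ℂ := fun y => (E y)⁻¹ * ∑ J ∈ (Finset.range N).powerset,
      {y | fibreIdx N S y = J}.indicator (fun y => ∑ j ∈ J, c J j * r j y) y
    have hw : MemLp w 2 haarAddCircle := by
      refine memLp_mul_of_norm_le_one hEm.inv hE1 (memLp_finsetSum _ fun J _ => ?_)
      exact (memLp_finsetSum _ fun j _ => (hr j).const_mul (c J j)).indicator
        (measurableSet_fibreIdx_eq N hS J)
    have hw' : ∀ y, E y * w y = ∑ j ∈ fibreIdx N S y, c (fibreIdx N S y) j * r j y := by
      intro y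
      simp only [w]
      rw [mul_inv_cancel_left₀ (hE0 y), Finset.sum_eq_single (fibreIdx N S y)]
      · simp
      · intro J _ hJ
        exact indicator_of_notMem (fun h' => hJ h'.symm) _
      · intro h'
        exact absurd (Finset.mem_powerset.2 (fibreIdx_subset N S y)) h'
    obtain ⟨gk, hgk, hgw⟩ := (h k hk).1 w hw
    refine ⟨Function.update g k gk, fun n hn1 hn2 => ?_, ?_⟩
    · rcases eq_or_ne n k with rfl | hne
      · simpa using hgk
      · simpa [hne] using hg n (by omega) hn2
    · filter_upwards [hae, hgw] with y hy hyw hky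
      have hsum : ∀ j, ∑ n ∈ Finset.Ico k N,
          fourier (n : ℤ) (fibrePt N j y) * Function.update g k gk n y =
          E y * (ω ^ j) ^ k * gk y + ∑ n ∈ Finset.Ico (k + 1) N,
            fourier (n : ℤ) (fibrePt N j y) * g n y := by
        intro j
        rw [Finset.sum_eq_sum_Ico_succ_bot hk, Function.update_self, fourier_fibrePt]
        congr 1
        refine Finset.sum_congr rfl fun n hn => ?_
        rw [Function.update_of_ne (by rw [Finset.mem_Ico] at hn; omega)]
      simp_rw [hsum]
      rcases hky.eq_or_lt with heq | hlt
      -- With exactly k points the system is square, hence solvable whatever g_k(y) is.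
      · obtain ⟨z, hz⟩ := exists_vandermonde_solution (injOn_rootOfUnity_pow N hN S y)
          fun j => r j y - E y * (ω ^ j) ^ k * gk y
        rw [← heq] at hz
        refine ⟨z, fun j hj => ?_⟩
        rw [hz j hj]
        simp only [r]
        ring
      · obtain ⟨z, hz⟩ := hy hlt
        have hrz : ∀ j ∈ fibreIdx N S y,
            r j y = ∑ n ∈ Finset.range (k + 1), (ω ^ j) ^ n * z n := fun j hj => by
          simp only [r]; rw [← hz j hj]; ring
        -- With more than k points, the functional shows that the solution of the previous stage has
        -- z_k equal to the term of g_k, which then passes from the unknowns to the chosen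
        -- functions.
        have hzk : z k = E y * gk y := by
          rw [hyw hlt, hw', Finset.sum_congr rfl fun j hj => by rw [hrz j hj, Finset.mul_sum],
            Finset.sum_comm]
          simp_rw [← mul_assoc, ← Finset.sum_mul]
          rw [Finset.sum_congr rfl fun n hn => by
            rw [hc _ ⟨y, rfl⟩ hlt n (by rw [Finset.mem_range] at hn; omega)]]
          simp
        refine ⟨z, fun j hj => ?_⟩
        rw [← hz j hj, Finset.sum_range_succ, hzk]
        ring

theorem IsRieszSpectrum.combine {N : ℕ} (hN : 0 < N) {S : Set UnitAddCircle}
    (hS : MeasurableSet S) {Λ : ℕ → Set ℤ}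
    (h : ∀ n < N, IsRieszSpectrum (Λ n) {y | n < (fibreIdx N S y).card}) :
    IsRieszSpectrum {m | ∃ n < N, ∃ k ∈ Λ n, m = N * k + n} S := by
  constructor
  · intro G hG
    obtain ⟨g, hg, hae⟩ := exists_fibre_system hN hS h hG (Nat.zero_le N)
    have hgm : ∀ n < N, MemLp (g n) 2 haarAddCircle := fun n hn => (hg n n.zero_le hn).1
    refine ⟨_, ⟨memLp_sum_dilation hN hgm, fun m hm => ?_⟩, ?_⟩
    · obtain ⟨n, hn, k, rfl⟩ := exists_residue hN m
      rw [fourierCoeff_sum_dilation hN hgm hn]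
      exact (hg n n.zero_le hn).2 k fun hk => hm ⟨n, hn, k, hk, rfl⟩
    · refine ae_of_ae_fibrePt hN ?_
      filter_upwards [hae] with y hy j hj hjS
      obtain ⟨z, hz⟩ := hy (Nat.zero_le _)
      rw [← hz j (mem_fibreIdx.2 ⟨hj, hjS⟩)]
      simp [nsmul_fibrePt hN]
  · intro f hf hf0
    obtain ⟨g, hg, hgc, hfg⟩ := exists_eq_sum_dilation hN hf.1
    have hgs : ∀ n < N, HasSpectrumIn (Λ n) (g n) := by
      refine fun n hn => ⟨hg n hn, fun k hk => ?_⟩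
      rw [hgc n hn]
      refine hf.2 _ ?_
      rintro ⟨n', hn', k', hk', he⟩
      have h1 : ((n : ℤ) + N * k) % N = (n' + N * k') % N := by rw [add_comm, he, add_comm]
      rw [Int.add_mul_emod_self_left, Int.add_mul_emod_self_left,
        Int.emod_eq_of_lt (by positivity) (by exact_mod_cast hn),
        Int.emod_eq_of_lt (by positivity) (by exact_mod_cast hn')] at h1
      obtain rfl : n = n' := by exact_mod_cast h1
      have : k = k' := by
        have hN' : (N : ℤ) ≠ 0 := by exact_mod_cast hN.ne'
        exact mul_left_cancel₀ hN' (by linarith)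
      exact hk (this ▸ hk')
    have hsys : ∀ᵐ y ∂haarAddCircle, ∀ j ∈ fibreIdx N S y,
        ∑ n ∈ Finset.range N, fourier (n : ℤ) (fibrePt N j y) * g n y = 0 := by
      have h1 : ∀ᵐ x ∂haarAddCircle, x ∈ S →
          ∑ n ∈ Finset.range N, fourier (n : ℤ) x * g n (N • x) = 0 := by
        filter_upwards [hfg, hf0] with x hx1 hx2 hxS
        rw [← hx2 hxS, hx1]
      filter_upwards [ae_forall_fibrePt hN h1] with y hy j hj
      simpa [nsmul_fibrePt hN] using hy j (mem_fibreIdx.1 hj).2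
    -- Uniqueness descends in the same order: once g_n = 0 for n > k, the functional gives g_k = 0
    -- where more than k fibre points lie in S, and the hypothesis on Λ_k spreads this to the whole
    -- circle.
    have hzero : ∀ k ≤ N, ∀ n, k ≤ n → n < N → g n =ᵐ[haarAddCircle] 0 := by
      intro k hk
      induction hk using Nat.decreasingInduction with
      | self => intro n h1 h2; omega
      | of_succ k hk ih =>
        intro n hn1 hn2
        rcases hn1.eq_or_lt with rfl | hlt
        · refine (h k hk).2 _ (hgs k hk) ?_
          have hall : ∀ᵐ y ∂haarAddCircle, ∀ n, k + 1 ≤ n → n < N → g n y = 0 :=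
            ae_all_iff.2 fun n => by
              by_cases hn : k + 1 ≤ n ∧ n < N
              · filter_upwards [ih n hn.1 hn.2] with y hy _ _ using hy
              · exact Eventually.of_forall fun y h1 h2 => absurd ⟨h1, h2⟩ hn
          filter_upwards [hsys, hall] with y hy hy0 hky
          obtain ⟨c, hc⟩ := exists_vandermonde_functional (injOn_rootOfUnity_pow N hN S y) hky
          set E : ℕ → ℂ := fun n => Complex.exp (2 * Real.pi * Complex.I / N * circleRep 0 y * n)
          set ω : ℂ := Complex.exp (2 * Real.pi * Complex.I / N) with hω
          have h2 : ∀ j ∈ fibreIdx N S y,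
              ∑ n ∈ Finset.range (k + 1), (ω ^ j) ^ n * (E n * g n y) = 0 := by
            intro j hj
            rw [← hy j hj, ← Finset.sum_subset (Finset.range_mono (Nat.succ_le_iff.2 hk))]
            · refine Finset.sum_congr rfl fun n _ => ?_
              rw [fourier_fibrePt]
              ring
            · intro n hn hn'
              rw [Finset.mem_range] at hn hn'
              rw [hy0 n (by omega) hn, mul_zero]
          have h3 : ∑ j ∈ fibreIdx N S y,
              c j * ∑ n ∈ Finset.range (k + 1), (ω ^ j) ^ n * (E n * g n y) = 0 :=
            Finset.sum_eq_zero fun j hj => by rw [h2 j hj, mul_zero]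
          simp_rw [Finset.mul_sum] at h3
          rw [Finset.sum_comm] at h3
          simp_rw [← mul_assoc (c _), ← Finset.sum_mul] at h3
          rw [Finset.sum_congr rfl fun n hn => by
            rw [hc n (by rw [Finset.mem_range] at hn; omega)]] at h3
          simp only [ite_mul, one_mul, zero_mul, Finset.sum_ite_eq', Finset.mem_range,
            Nat.lt_succ_self, if_true] at h3
          exact (mul_eq_zero.1 h3).resolve_left (Complex.exp_ne_zero _)
        · exact ih n hlt hn2
    have hall : ∀ᵐ y ∂haarAddCircle, ∀ n, n < N → g n y = 0 :=
      ae_all_iff.2 fun n => by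
        by_cases hn : n < N
        · filter_upwards [hzero 0 (Nat.zero_le _) n n.zero_le hn] with y hy _ using hy
        · exact Eventually.of_forall fun y h1 => absurd h1 hn
    filter_upwards [hfg, (measurePreserving_nsmul_circle hN).quasiMeasurePreserving.ae hall]
      with x hx hx0
    rw [hx]
    exact Finset.sum_eq_zero fun n hn => by rw [hx0 n (Finset.mem_range.1 hn), mul_zero]

/-! ### Integer valued periodic step functions -/

/-- `f` is, up to a constant, a sum of `L` upward and `L` downward periodic unit jumps. -/
def IsFloorSum (L : ℕ) (f : ℝ → ℤ) : Prop :=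
  ∃ (c : ℤ) (a b : ℕ → ℝ), ∀ t, f t = c + ∑ i ∈ Finset.range L, (⌊t - a i⌋ - ⌊t - b i⌋)

theorem IsFloorSum.succ {L : ℕ} {f : ℝ → ℤ} (h : IsFloorSum L f) : IsFloorSum (L + 1) f := by
  obtain ⟨c, a, b, h⟩ := h
  refine ⟨c, fun i => if i < L then a i else 0, fun i => if i < L then b i else 0, fun t => ?_⟩
  rw [Finset.sum_range_succ, h]
  simp only [lt_self_iff_false, if_false, sub_self, add_zero]
  congr 1
  refine Finset.sum_congr rfl fun i hi => ?_
  simp [Finset.mem_range.1 hi]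

theorem IsFloorSum.add_const {L : ℕ} {f : ℝ → ℤ} (h : IsFloorSum L f) (k : ℤ) :
    IsFloorSum L fun t => f t + k := by
  obtain ⟨c, a, b, h⟩ := h
  exact ⟨c + k, a, b, fun t => by simp only [h]; ring⟩

theorem IsFloorSum.add {L L' : ℕ} {f g : ℝ → ℤ} (hf : IsFloorSum L f) (hg : IsFloorSum L' g) :
    IsFloorSum (L + L') fun t => f t + g t := by
  obtain ⟨c, a, b, h⟩ := hf
  obtain ⟨c', a', b', h'⟩ := hg
  refine ⟨c + c', fun i => if i < L then a i else a' (i - L),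
    fun i => if i < L then b i else b' (i - L), fun t => ?_⟩
  have e : ∀ i ∈ Finset.range L, (⌊t - if i < L then a i else a' (i - L)⌋ -
      ⌊t - if i < L then b i else b' (i - L)⌋) = ⌊t - a i⌋ - ⌊t - b i⌋ := fun i hi => by
    rw [if_pos (Finset.mem_range.1 hi), if_pos (Finset.mem_range.1 hi)]
  rw [Finset.sum_range_add, Finset.sum_congr rfl e]
  simp only [h, h']
  simp only [add_lt_iff_neg_left, not_lt_zero, if_false, add_tsub_cancel_left]
  ring

/-- Raising A by one replaces the numerator A + 1 - M by A + 1, so the sum grows by exactly one. -/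
theorem exists_sum_ediv (M : ℕ) (hM : 0 < M) :
    ∃ c : ℤ, ∀ A : ℤ, ∑ i ∈ Finset.range M, (A - i) / (M : ℤ) = A + c := by
  have hM' : (M : ℤ) ≠ 0 := by exact_mod_cast hM.ne'
  have step : ∀ A : ℤ, ∑ i ∈ Finset.range M, (A + 1 - i) / (M : ℤ) =
      ∑ i ∈ Finset.range M, (A - i) / (M : ℤ) + 1 := by
    intro A
    have h1 := Finset.sum_range_succ (fun i : ℕ => (A + 1 - i) / (M : ℤ)) M
    rw [Finset.sum_range_succ'] at h1
    have h2 : (A + 1 - (0 : ℕ)) / (M : ℤ) = (A + 1 - M) / (M : ℤ) + 1 := by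
      rw [show A + 1 - ((0 : ℕ) : ℤ) = (A + 1 - M) + 1 * M by push_cast; ring,
        Int.add_mul_ediv_right _ _ hM']
    have h3 : ∀ i : ℕ, (A + 1 - ((i + 1 : ℕ) : ℤ)) = A - i := fun i => by push_cast; ring
    simp_rw [h3] at h1
    linarith
  refine ⟨∑ i ∈ Finset.range M, (0 - (i : ℤ)) / (M : ℤ), fun A => ?_⟩
  induction A using Int.induction_on with
  | zero => simp
  | succ n ih => rw [step, ih]; ring
  | pred n ih =>
    have := step (-(n : ℤ) - 1)
    rw [sub_add_cancel] at this
    linarith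

/-- Hermite's identity up to a constant: folding carries a jump at a to a jump at N a. -/
theorem sum_floor_fibre {N : ℕ} (hN : 0 < N) :
    ∃ c : ℤ, ∀ t a : ℝ, ∑ j ∈ Finset.range N, ⌊(t + j) / N - a⌋ = ⌊t - N * a⌋ + c := by
  obtain ⟨c, hc⟩ := exists_sum_ediv N hN
  refine ⟨N - 1 + c, fun t a => ?_⟩
  have hN' : (N : ℝ) ≠ 0 := by positivity
  have h : ∀ j : ℕ, ⌊(t + j) / N - a⌋ = (⌊t - N * a⌋ + j) / (N : ℤ) := by
    intro j
    rw [show (t + j) / N - a = ((t - N * a) + (j : ℤ)) / N by field_simp; push_cast; ring,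
      Int.floor_div_natCast, Int.floor_add_intCast]
  simp_rw [h]
  rw [← Finset.sum_range_reflect, ← add_assoc, ← hc]
  refine Finset.sum_congr rfl fun j hj => ?_
  congr 1
  have := Finset.mem_range.1 hj
  omega

theorem floorSum_fold {N : ℕ} (hN : 0 < N) {L : ℕ} {f : ℝ → ℤ} {c : ℤ} {a b : ℕ → ℝ}
    (h : ∀ t, f t = c + ∑ i ∈ Finset.range L, (⌊t - a i⌋ - ⌊t - b i⌋)) (t : ℝ) :
    ∑ j ∈ Finset.range N, f ((t + j) / N) =
      N * c + ∑ i ∈ Finset.range L, (⌊t - N * a i⌋ - ⌊t - N * b i⌋) := by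
  obtain ⟨d, hd⟩ := sum_floor_fibre hN
  simp_rw [h]
  rw [Finset.sum_add_distrib, Finset.sum_comm]
  simp [Finset.sum_sub_distrib, hd]

/-- `x` enumerates the jumps of the nondecreasing function `α`, which has `M` jumps per period. -/
def IsJumpSeq (M : ℕ) (x : ℤ → ℝ) (α : ℝ → ℤ) : Prop :=
  (∀ j, x (j + M) = x j + 1) ∧ ∀ j t, x j ≤ t ↔ j ≤ α t

/-- Take x j to be the infimum of {t | j ≤ α t}. Right continuity of the floor makes it attained,
which gives the Galois relation. -/
theorem exists_isJumpSeq {M : ℕ} (hM : 0 < M) (a : ℕ → ℝ) :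
    ∃ x, IsJumpSeq M x fun t => ∑ i ∈ Finset.range M, ⌊t - a i⌋ := by
  set α : ℝ → ℤ := fun t => ∑ i ∈ Finset.range M, ⌊t - a i⌋ with hα
  have hmono : Monotone α := fun s t hst =>
    Finset.sum_le_sum fun i _ => Int.floor_le_floor (by linarith)
  have hper : ∀ (t : ℝ) (n : ℤ), α (t + n) = α t + n * M := by
    intro t n
    simp only [hα, show ∀ i, t + n - a i = t - a i + n from fun i => by ring,
      Int.floor_add_intCast, Finset.sum_add_distrib]
    simp [mul_comm]
  have hM' : (1 : ℤ) ≤ M := by exact_mod_cast hM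
  have hne : ∀ j : ℤ, {t | j ≤ α t}.Nonempty := by
    intro j
    refine ⟨0 + (|j - α 0| : ℤ), ?_⟩
    rw [mem_ofPred_eq, hper]
    nlinarith [le_abs_self (j - α 0), abs_nonneg (j - α 0)]
  have hbdd : ∀ j : ℤ, BddBelow {t | j ≤ α t} := by
    intro j
    refine ⟨0 + ((-(|α 0 - j| + 1) : ℤ) : ℝ), fun t ht => ?_⟩
    by_contra hlt
    have h1 := hmono (not_le.1 hlt).le
    rw [hper] at h1
    have h2 : j ≤ α t := ht
    nlinarith [le_abs_self (α 0 - j), abs_nonneg (α 0 - j)]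
  have hrc : ∀ t, ∀ᶠ s in nhdsWithin t (Ici t), α s = α t := by
    intro t
    have h1 : ∀ i ∈ Finset.range M, ∀ᶠ s in nhdsWithin t (Ici t), ⌊s - a i⌋ = ⌊t - a i⌋ := by
      intro i _
      have h2 : Tendsto (fun s => s - a i) (nhdsWithin t (Ici t))
          (nhdsWithin (t - a i) (Ici (t - a i))) :=
        tendsto_nhdsWithin_iff.2 ⟨((continuous_sub_right (a i)).tendsto t).mono_left
          nhdsWithin_le_nhds, eventually_mem_nhdsWithin.mono fun s hs => by
            simpa using hs⟩
      exact tendsto_pure.1 ((tendsto_floor_right_pure_floor (t - a i)).comp h2)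
    filter_upwards [(Finset.eventually_all _).2 h1] with s hs
    exact Finset.sum_congr rfl hs
  have hgal : ∀ (j : ℤ) (t : ℝ), sInf {t | j ≤ α t} ≤ t ↔ j ≤ α t := by
    intro j t
    refine ⟨fun h => ?_, fun h => csInf_le (hbdd j) h⟩
    set x := sInf {t | j ≤ α t} with hx
    have hjx : j ≤ α x := by
      obtain ⟨u, hu, hu'⟩ := mem_nhdsGE_iff_exists_Ico_subset.1 (hrc x)
      obtain ⟨s, hs, hsu⟩ := (csInf_lt_iff (hbdd j) (hne j)).1 (show sInf _ < u from hu)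
      have : α s = α x := hu' ⟨csInf_le (hbdd j) hs, hsu⟩
      rw [← this]; exact hs
    exact hjx.trans (hmono h)
  refine ⟨fun j => sInf {t | j ≤ α t}, fun j => ?_, hgal⟩
  refine eq_of_forall_ge_iff fun t => ?_
  have := hper (t - 1) 1
  rw [Int.cast_one, sub_add_cancel, one_mul] at this
  dsimp only
  rw [hgal, ← le_sub_iff_add_le, ← le_sub_iff_add_le, hgal, this]
  omega

/-- The Galois relation gives ⌊t - x j⌋ = ⌊(α t - j) / M⌋, and M consecutive such terms sum to α t
plus a constant. The free starting index p allows a jump shared by two functions to be put first and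
cancelled. -/
theorem IsJumpSeq.exists_eq {M : ℕ} (hM : 0 < M) {x : ℤ → ℝ} {α : ℝ → ℤ} (h : IsJumpSeq M x α)
    (p : ℤ) : ∃ c : ℤ, ∀ t, α t = c + ∑ i ∈ Finset.range M, ⌊t - x (p + i)⌋ := by
  have hM' : (0 : ℤ) < M := by exact_mod_cast hM
  obtain ⟨c, hc⟩ := exists_sum_ediv M hM
  have hx : ∀ (q j : ℤ), x (j + q * M) = x j + q := by
    intro q j
    induction q using Int.induction_on with
    | zero => simp
    | succ n ih =>
      rw [show j + ((n : ℤ) + 1) * M = j + n * M + M by ring, h.1, ih]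
      push_cast; ring
    | pred n ih =>
      have := h.1 (j + (-(n : ℤ) - 1) * M)
      rw [show j + (-(n : ℤ) - 1) * M + M = j + -(n : ℤ) * M by ring, ih] at this
      push_cast at this ⊢
      linarith
  have hfl : ∀ (j : ℤ) (t : ℝ), ⌊t - x j⌋ = (α t - j) / (M : ℤ) := by
    intro j t
    refine eq_of_forall_le_iff fun q => ?_
    rw [Int.le_floor, Int.le_ediv_iff_mul_le hM', le_sub_iff_add_le', ← hx, h.2]
    omega
  refine ⟨p - c, fun t => ?_⟩
  simp_rw [hfl, show ∀ i : ℕ, α t - (p + i) = α t - p - i from fun i => by ring]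
  rw [hc]
  ring

theorem isFloorSum_of_common_jump {L : ℕ} {u w : ℤ → ℝ} {α β : ℝ → ℤ}
    (hu : IsJumpSeq (L + 1) u α) (hw : IsJumpSeq (L + 1) w β) {p q : ℤ} (hpq : u p = w q) :
    IsFloorSum L fun t => α t - β t := by
  obtain ⟨c, hc⟩ := hu.exists_eq (M := L + 1) L.succ_pos p
  obtain ⟨d, hd⟩ := hw.exists_eq (M := L + 1) L.succ_pos q
  refine ⟨c - d, fun i => u (p + (i + 1 : ℕ)), fun i => w (q + (i + 1 : ℕ)), fun t => ?_⟩
  dsimp only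
  rw [hc, hd, Finset.sum_range_succ', Finset.sum_range_succ', Finset.sum_sub_distrib]
  simp only [Nat.cast_zero, add_zero, hpq]
  ring

/-- Superlevel sets of a step function have fewer jumps, unless the function takes only two
consecutive values. -/
theorem IsFloorSum.superlevel {L : ℕ} {f : ℝ → ℤ} (hf : IsFloorSum (L + 1) f) (n : ℤ) :
    IsFloorSum L (fun t => if n ≤ f t then 1 else 0) ∨ ∀ t, f t = n ∨ f t = n - 1 := by
  obtain ⟨c, a, b, hf⟩ := hf
  obtain ⟨x, hx⟩ := exists_isJumpSeq (M := L + 1) L.succ_pos a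
  obtain ⟨y, hy⟩ := exists_isJumpSeq (M := L + 1) L.succ_pos b
  set α : ℝ → ℤ := fun t => ∑ i ∈ Finset.range (L + 1), ⌊t - a i⌋
  set β : ℝ → ℤ := fun t => ∑ i ∈ Finset.range (L + 1), ⌊t - b i⌋
  have hfab : ∀ t, f t = c + (α t - β t) := fun t => by rw [hf, Finset.sum_sub_distrib]
  have hu : ∀ m : ℤ, IsJumpSeq (L + 1) (fun j => max (x j) (y (j - m)))
      fun t => min (α t) (β t + m) := by
    intro m
    refine ⟨fun j => ?_, fun j t => ?_⟩
    · dsimp only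
      rw [hx.1, show j + ((L + 1 : ℕ) : ℤ) - m = j - m + ((L + 1 : ℕ) : ℤ) by ring, hy.1,
        max_add_add_right]
    · dsimp only
      rw [max_le_iff, hx.2, hy.2, le_min_iff, sub_le_iff_le_add]
  -- As f = c + α - β, the two minima differ by 1 exactly when f ≥ n, and agree otherwise. By `hu`
  -- their jump sequences are maxima of x and a shift of y.
  have hind : (fun t => if n ≤ f t then (1 : ℤ) else 0) =
      fun t => min (α t) (β t + (n - c)) - min (α t) (β t + (n - c - 1)) := by
    ext t
    rw [hfab]
    split_ifs <;> omega
  by_cases h1 : ∃ j, max (x j) (y (j - (n - c))) = max (x j) (y (j - (n - c - 1)))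
  · obtain ⟨j, hj⟩ := h1
    left
    rw [hind]
    exact isFloorSum_of_common_jump (hu _) (hu _) hj
  by_cases h2 : ∃ j, max (x (j + 1)) (y (j + 1 - (n - c))) = max (x j) (y (j - (n - c - 1)))
  · obtain ⟨j, hj⟩ := h2
    left
    rw [hind]
    exact isFloorSum_of_common_jump (hu _) (hu _) hj
  right
  push Not at h1 h2
  have hxm : ∀ i j, i ≤ j → x i ≤ x j := fun i j hij =>
    (hx.2 i _).2 (hij.trans ((hx.2 j _).1 le_rfl))
  have hym : ∀ i j, i ≤ j → y i ≤ y j := fun i j hij =>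
    (hy.2 i _).2 (hij.trans ((hy.2 j _).1 le_rfl))
  -- Without a common jump, upward and downward jumps interlace strictly (`hA`, `hB`), which
  -- confines f to n and n - 1.
  have hA : ∀ j, x j < y (j - (n - c - 1)) := by
    intro j
    by_contra hle
    rw [not_lt] at hle
    exact h1 j (by rw [max_eq_left hle, max_eq_left ((hym _ _ (by omega)).trans hle)])
  have hB : ∀ j, y (j - (n - c - 1)) < x (j + 1) := by
    intro j
    by_contra hle
    rw [not_lt] at hle
    have e : j + 1 - (n - c) = j - (n - c - 1) := by ring
    exact h2 j (by rw [e, max_eq_right hle, max_eq_right (hA j).le])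
  intro t
  have e1 : x (α t) ≤ t := (hx.2 _ _).2 le_rfl
  have e2 : ¬ x (α t + 1) ≤ t := fun h => by have := (hx.2 _ _).1 h; omega
  have e3 : α t - 1 - (n - c - 1) ≤ β t := (hy.2 _ _).1 (by
    have := hB (α t - 1)
    rw [sub_add_cancel] at this
    linarith)
  have e4 : ¬ α t + 1 - (n - c - 1) ≤ β t := fun h => by
    have := (hy.2 _ _).2 h
    have := hA (α t + 1)
    linarith
  rw [hfab]
  omega

theorem IsFloorSum.superlevel_same {L : ℕ} {f : ℝ → ℤ} (hf : IsFloorSum L f) (n : ℤ) :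
    IsFloorSum L (fun t => if n ≤ f t then 1 else 0) := by
  rcases L with _ | L
  · obtain ⟨c, a, b, hf⟩ := hf
    exact ⟨if n ≤ c then 1 else 0, a, b, fun t => by simp [hf]⟩
  · rcases hf.superlevel n with h | h
    · exact h.succ
    · convert hf.add_const (1 - n) using 2 with t
      rcases h t with h | h <;> rw [h] <;> split_ifs <;> omega

/-! ### Averages of exponential sums -/

/-- The character `x ↦ e^{2πix}`. -/
noncomputable def expTwoPi (x : ℝ) : ℂ := Complex.exp (2 * Real.pi * Complex.I * x)

theorem expTwoPi_add (x y : ℝ) : expTwoPi (x + y) = expTwoPi x * expTwoPi y := by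
  rw [expTwoPi, expTwoPi, expTwoPi, ← Complex.exp_add]
  congr 1; push_cast; ring

@[simp] theorem norm_expTwoPi (x : ℝ) : ‖expTwoPi x‖ = 1 := by
  rw [expTwoPi, show (2 * Real.pi * Complex.I * x : ℂ) = ((2 * Real.pi * x : ℝ) : ℂ) * Complex.I by
    push_cast; ring, Complex.norm_exp_ofReal_mul_I]

theorem expTwoPi_neg (x : ℝ) : expTwoPi (-x) = (starRingEnd ℂ) (expTwoPi x) := by
  rw [expTwoPi, expTwoPi, ← Complex.exp_conj]
  congr 1
  rw [show (2 * Real.pi * Complex.I * x : ℂ) = ((2 * Real.pi * x : ℝ) : ℂ) * Complex.I by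
    push_cast; ring, map_mul, Complex.conj_ofReal, Complex.conj_I]
  push_cast; ring

theorem expTwoPi_eq_one_iff {x : ℝ} : expTwoPi x = 1 ↔ ∃ k : ℤ, x = k := by
  rw [expTwoPi, Complex.exp_eq_one_iff]
  refine exists_congr fun k => ?_
  rw [mul_comm (k : ℂ), mul_right_inj' Complex.two_pi_I_ne_zero]
  exact_mod_cast Iff.rfl

theorem expTwoPi_nat_mul (n : ℕ) (x : ℝ) : expTwoPi (n * x) = expTwoPi x ^ n := by
  rw [expTwoPi, expTwoPi, ← Complex.exp_nat_mul]
  congr 1; push_cast; ring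

@[fun_prop] theorem continuous_expTwoPi : Continuous expTwoPi := by
  unfold expTwoPi; fun_prop

open Classical in
theorem tendsto_average_expTwoPi (x : ℝ) :
    Tendsto (fun K : ℕ => (K : ℂ)⁻¹ * ∑ n ∈ Finset.range K, expTwoPi (n * x)) atTop
      (nhds (if ∃ k : ℤ, x = k then 1 else 0)) := by
  simp_rw [expTwoPi_nat_mul]
  split_ifs with h
  · rw [expTwoPi_eq_one_iff.2 h]
    refine tendsto_const_nhds.congr' ?_
    filter_upwards [eventually_gt_atTop 0] with K hK
    have : (K : ℂ) ≠ 0 := by exact_mod_cast hK.ne'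
    simp [this]
  · have hq : expTwoPi x ≠ 1 := fun h' => h (expTwoPi_eq_one_iff.1 h')
    have hq' : expTwoPi x - 1 ≠ 0 := sub_ne_zero.2 hq
    refine squeeze_zero_norm (a := fun K : ℕ => (2 / ‖expTwoPi x - 1‖) * (K : ℝ)⁻¹) (fun K => ?_) ?_
    · rw [norm_mul, norm_inv, Complex.norm_natCast, geom_sum_eq hq, norm_div, mul_comm]
      gcongr
      refine (norm_sub_le _ _).trans ?_
      rw [norm_pow, norm_expTwoPi]
      norm_num
    · simpa using tendsto_inv_atTop_nhds_zero_nat.const_mul (2 / ‖expTwoPi x - 1‖)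

theorem norm_sq_expSum {ι : Type*} [Fintype ι] (ε x : ι → ℝ) :
    ((‖∑ p, (ε p : ℂ) * expTwoPi (x p)‖ ^ 2 : ℝ) : ℂ) =
      ∑ p, ∑ q, ((ε p * ε q : ℝ) : ℂ) * expTwoPi (x p - x q) := by
  rw [Complex.ofReal_pow, ← Complex.mul_conj', map_sum, Finset.sum_mul_sum]
  refine Finset.sum_congr rfl fun p _ => Finset.sum_congr rfl fun q _ => ?_
  rw [map_mul, Complex.conj_ofReal, ← expTwoPi_neg, sub_eq_add_neg, expTwoPi_add]
  push_cast; ring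

/-- The mean square of an exponential sum with signs `±1` is at least the number of terms, if
frequencies of opposite sign are distinct modulo `1`. -/
theorem exists_tendsto_average_norm_sq {ι : Type*} [Fintype ι] (ε x : ι → ℝ)
    (hε : ∀ p, ε p = 1 ∨ ε p = -1) (hx : ∀ p q, ε p ≠ ε q → ∀ k : ℤ, x p - x q ≠ k) :
    ∃ A : ℝ, (Fintype.card ι : ℝ) ≤ A ∧
      Tendsto (fun K : ℕ => (K : ℝ)⁻¹ *
        ∑ n ∈ Finset.range K, ‖∑ p, (ε p : ℂ) * expTwoPi (n * x p)‖ ^ 2) atTop (nhds A) := by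
  classical
  -- Only pairs of frequencies congruent modulo 1 survive averaging. Their signs agree, so no term
  -- is negative, and the diagonal contributes 1 for each p.
  set A : ℝ := ∑ p, ∑ q, (ε p * ε q) * (if ∃ k : ℤ, x p - x q = k then 1 else 0) with hA
  refine ⟨A, ?_, ?_⟩
  · have h1 : ∀ p, (1 : ℝ) ≤ ∑ q, (ε p * ε q) * (if ∃ k : ℤ, x p - x q = k then 1 else 0) := by
      intro p
      have h2 : ∀ q, 0 ≤ (ε p * ε q) * (if ∃ k : ℤ, x p - x q = k then (1 : ℝ) else 0) := by
        intro q
        split_ifs with h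
        · have : ε p = ε q := by
            by_contra hne
            obtain ⟨k, hk⟩ := h
            exact hx p q hne k hk
          rw [this, mul_one]
          exact mul_self_nonneg _
        · simp
      refine le_trans (le_of_eq ?_) (Finset.single_le_sum (fun q _ => h2 q) (Finset.mem_univ p))
      rw [if_pos ⟨0, by simp⟩]
      rcases hε p with h | h <;> rw [h] <;> norm_num
    calc (Fintype.card ι : ℝ) = ∑ p : ι, (1 : ℝ) := by simp
      _ ≤ A := Finset.sum_le_sum fun p _ => h1 p
  · have h : Tendsto (fun K : ℕ => ∑ p, ∑ q, ((ε p * ε q : ℝ) : ℂ) *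
        ((K : ℂ)⁻¹ * ∑ n ∈ Finset.range K, expTwoPi (n * (x p - x q)))) atTop (nhds (A : ℂ)) := by
      rw [hA]
      push_cast
      refine tendsto_finsetSum _ fun p _ => tendsto_finsetSum _ fun q _ => ?_
      rw [show (((if ∃ k : ℤ, x p - x q = k then 1 else 0 : ℝ)) : ℂ) =
        if ∃ k : ℤ, x p - x q = k then 1 else 0 by split_ifs <;> simp]
      exact (tendsto_average_expTwoPi (x p - x q)).const_mul ((ε p : ℂ) * ε q)
    have h' := (Complex.continuous_re.tendsto _).comp h
    rw [Complex.ofReal_re] at h'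
    refine h'.congr fun K => ?_
    rw [Function.comp_apply, ← Complex.ofReal_re ((K : ℝ)⁻¹ * _)]
    congr 1
    push_cast
    have e : ∀ n : ℕ, ((‖∑ p, (ε p : ℂ) * expTwoPi (n * x p)‖ : ℝ) : ℂ) ^ 2 =
        ∑ p, ∑ q, ((ε p : ℂ) * ε q) * expTwoPi (n * (x p - x q)) := by
      intro n
      rw [← Complex.ofReal_pow, norm_sq_expSum ε fun p => n * x p]
      push_cast
      simp_rw [mul_sub]
    simp_rw [e, Finset.mul_sum]
    symm
    rw [Finset.sum_comm]
    refine Finset.sum_congr rfl fun p _ => ?_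
    rw [Finset.sum_comm]
    refine Finset.sum_congr rfl fun q _ => Finset.sum_congr rfl fun n _ => ?_
    ring

/-! ### Fourier coefficients of step functions -/

theorem expTwoPi_int (k : ℤ) : expTwoPi k = 1 := expTwoPi_eq_one_iff.2 ⟨k, rfl⟩

theorem intervalIntegrable_of_bounded {g : ℝ → ℂ} (hg : Measurable g) {C : ℝ} (hC : ∀ t, ‖g t‖ ≤ C)
    (a b : ℝ) : IntervalIntegrable g volume a b :=
  (intervalIntegrable_const (c := C)).mono_fun hg.aestronglyMeasurable
    (Eventually.of_forall fun t => (hC t).trans (le_abs_self C))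

theorem integral_expTwoPi {k : ℤ} (hk : k ≠ 0) : ∫ t in (0 : ℝ)..1, expTwoPi (k * t) = 0 := by
  have hc : (2 * Real.pi * Complex.I * k : ℂ) ≠ 0 :=
    mul_ne_zero Complex.two_pi_I_ne_zero (by exact_mod_cast hk)
  have h := integral_exp_mul_complex (a := 0) (b := 1) hc
  have e : ∀ t : ℝ, Complex.exp (2 * Real.pi * Complex.I * k * t) = expTwoPi (k * t) := fun t => by
    rw [expTwoPi]; push_cast; ring_nf
  simp_rw [e] at h
  rw [h]
  simp [expTwoPi_int, show expTwoPi 0 = 1 by simpa using expTwoPi_int 0]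

theorem integral_id_mul_expTwoPi {k : ℤ} (hk : k ≠ 0) :
    ∫ t in (0 : ℝ)..1, (t : ℂ) * expTwoPi (k * t) = (2 * Real.pi * Complex.I * k)⁻¹ := by
  set c : ℂ := 2 * Real.pi * Complex.I * k with hcdef
  have hc : c ≠ 0 := mul_ne_zero Complex.two_pi_I_ne_zero (by exact_mod_cast hk)
  have e : ∀ t : ℝ, expTwoPi (k * t) = Complex.exp (c * t) := fun t => by
    rw [expTwoPi, hcdef]; push_cast; ring_nf
  have hd : ∀ t : ℝ, HasDerivAt (fun t : ℝ => ((t : ℂ) / c - 1 / c ^ 2) * Complex.exp (c * t))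
      ((t : ℂ) * Complex.exp (c * t)) t := by
    intro t
    have h1 : HasDerivAt (fun t : ℝ => (t : ℂ)) 1 t := Complex.ofRealCLM.hasDerivAt
    have h2 : HasDerivAt (fun t : ℝ => (t : ℂ) / c - 1 / c ^ 2) (1 / c) t :=
      (h1.div_const c).sub_const _
    have h3 : HasDerivAt (fun t : ℝ => Complex.exp (c * t)) (Complex.exp (c * t) * (c * 1)) t :=
      (h1.const_mul c).cexp
    refine (h2.mul h3).congr_deriv ?_
    field_simp
    ring
  simp_rw [e]
  rw [intervalIntegral.integral_eq_sub_of_hasDerivAt (fun t _ => hd t)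
    (Continuous.intervalIntegrable (by fun_prop) _ _)]
  have h1 : Complex.exp (c * (1 : ℝ)) = 1 := by
    rw [← e]; simpa using expTwoPi_int k
  rw [h1]
  simp

/-- The integer step is b - a plus a difference of two sawtooth functions, and periodicity reduces
each sawtooth to the integral of t e(kt) over [0, 1]. -/
theorem integral_floor_sub_floor {k : ℤ} (hk : k ≠ 0) (a b : ℝ) :
    ∫ t in (0 : ℝ)..1, (((⌊t - a⌋ - ⌊t - b⌋ : ℤ) : ℝ) : ℂ) * expTwoPi (k * t) =
      (expTwoPi (k * b) - expTwoPi (k * a)) * (2 * Real.pi * Complex.I * k)⁻¹ := by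
  have hm : ∀ a : ℝ, Measurable fun t : ℝ => ((Int.fract (t - a) : ℝ) : ℂ) * expTwoPi (k * t) := by
    intro a
    have h1 : Measurable fun t : ℝ => Int.fract (t - a) :=
      measurable_fract.comp (measurable_sub_const a)
    exact (Complex.measurable_ofReal.comp h1).mul (by fun_prop)
  have hint : ∀ a : ℝ, IntervalIntegrable
      (fun t : ℝ => ((Int.fract (t - a) : ℝ) : ℂ) * expTwoPi (k * t)) volume 0 1 := by
    intro a
    refine intervalIntegrable_of_bounded (hm a) (C := 1) (fun t => ?_) _ _
    rw [norm_mul, norm_expTwoPi, mul_one, Complex.norm_real, Real.norm_of_nonneg (Int.fract_nonneg _)]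
    exact (Int.fract_lt_one _).le
  have hfr : ∀ a : ℝ, ∫ t in (0 : ℝ)..1, ((Int.fract (t - a) : ℝ) : ℂ) * expTwoPi (k * t) =
      expTwoPi (k * a) * (2 * Real.pi * Complex.I * k)⁻¹ := by
    intro a
    have hper : Function.Periodic
        (fun t : ℝ => ((Int.fract (t - a) : ℝ) : ℂ) * expTwoPi (k * t)) 1 := by
      intro t
      dsimp only
      rw [show t + 1 - a = t - a + 1 by ring, Int.fract_add_one, mul_add, expTwoPi_add, mul_one,
        expTwoPi_int, mul_one]
    have h1 := hper.intervalIntegral_add_eq 0 a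
    rw [zero_add] at h1
    rw [h1, ← integral_id_mul_expTwoPi hk, ← intervalIntegral.integral_const_mul]
    have h2 := intervalIntegral.integral_comp_add_right (a := 0) (b := 1)
      (fun t : ℝ => ((Int.fract (t - a) : ℝ) : ℂ) * expTwoPi (k * t)) a
    rw [zero_add, add_comm 1 a] at h2
    rw [← h2]
    have hne : ∀ᵐ t : ℝ, t ≠ 1 := by simp [ae_iff]
    refine intervalIntegral.integral_congr_ae ?_
    filter_upwards [hne] with t ht1 ht
    rw [uIoc_of_le zero_le_one] at ht
    rw [add_sub_cancel_right, Int.fract_eq_self.2 ⟨ht.1.le, lt_of_le_of_ne ht.2 ht1⟩, mul_add,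
      expTwoPi_add]
    ring
  have e : ∀ t : ℝ, (((⌊t - a⌋ - ⌊t - b⌋ : ℤ) : ℝ) : ℂ) * expTwoPi (k * t) =
      ((b - a : ℝ) : ℂ) * expTwoPi (k * t) +
      (((Int.fract (t - b) : ℝ) : ℂ) * expTwoPi (k * t) -
        ((Int.fract (t - a) : ℝ) : ℂ) * expTwoPi (k * t)) := by
    intro t
    rw [← sub_mul, ← add_mul]
    congr 1
    rw [← Int.self_sub_floor, ← Int.self_sub_floor]
    push_cast; ring
  simp_rw [e]
  rw [intervalIntegral.integral_add (Continuous.intervalIntegrable (by fun_prop) _ _)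
      ((hint b).sub (hint a)), intervalIntegral.integral_sub (hint b) (hint a), hfr, hfr,
    intervalIntegral.integral_const_mul, integral_expTwoPi hk]
  ring

theorem integral_floorSum {k : ℤ} (hk : k ≠ 0) (L : ℕ) (a b : ℕ → ℝ) (d : ℝ) :
    ∫ t in (0 : ℝ)..1, (((d + (∑ i ∈ Finset.range L, (⌊t - a i⌋ - ⌊t - b i⌋) : ℤ) : ℝ) : ℂ)) *
        expTwoPi (k * t) =
      (∑ i ∈ Finset.range L, (expTwoPi (k * b i) - expTwoPi (k * a i))) *
        (2 * Real.pi * Complex.I * k)⁻¹ := by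
  have hfl : ∀ a b : ℝ, IntervalIntegrable
      (fun t : ℝ => (((⌊t - a⌋ - ⌊t - b⌋ : ℤ) : ℝ) : ℂ) * expTwoPi (k * t)) volume 0 1 := by
    intro a b
    have h1 : ∀ a : ℝ, Measurable fun t : ℝ => ⌊t - a⌋ := fun a =>
      Int.measurable_floor.comp (measurable_sub_const a)
    have h2 : Measurable fun t : ℝ => ((⌊t - a⌋ - ⌊t - b⌋ : ℤ) : ℝ) :=
      (measurable_from_top (f := fun z : ℤ => (z : ℝ))).comp ((h1 a).sub (h1 b))
    have h2' : Measurable fun t : ℝ =>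
        (((⌊t - a⌋ - ⌊t - b⌋ : ℤ) : ℝ) : ℂ) * expTwoPi (k * t) :=
      (Complex.measurable_ofReal.comp h2).mul (by fun_prop)
    refine intervalIntegrable_of_bounded h2' (C := |b - a| + 2) (fun t => ?_) _ _
    rw [norm_mul, norm_expTwoPi, mul_one, Complex.norm_real, Real.norm_eq_abs]
    have h3 := Int.self_sub_floor (t - a)
    have h4 := Int.self_sub_floor (t - b)
    have h5 := Int.fract_nonneg (t - a)
    have h6 := Int.fract_nonneg (t - b)
    have h7 := Int.fract_lt_one (t - a)
    have h8 := Int.fract_lt_one (t - b)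
    push_cast
    rw [abs_le]
    constructor
    · linarith [neg_abs_le (b - a)]
    · linarith [le_abs_self (b - a)]
  have e : ∀ t : ℝ,
      (((d + (∑ i ∈ Finset.range L, (⌊t - a i⌋ - ⌊t - b i⌋) : ℤ) : ℝ) : ℂ)) * expTwoPi (k * t) =
      (d : ℂ) * expTwoPi (k * t) +
        ∑ i ∈ Finset.range L, (((⌊t - a i⌋ - ⌊t - b i⌋ : ℤ) : ℝ) : ℂ) * expTwoPi (k * t) := by
    intro t
    rw [← Finset.sum_mul, ← add_mul]
    push_cast
    rfl
  simp_rw [e]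
  rw [intervalIntegral.integral_add (Continuous.intervalIntegrable (by fun_prop) _ _),
    intervalIntegral.integral_const_mul, integral_expTwoPi hk, mul_zero, zero_add,
    intervalIntegral.integral_finsetSum fun i _ => hfl (a i) (b i), Finset.sum_mul]
  · exact Finset.sum_congr rfl fun i _ => integral_floor_sub_floor hk _ _
  · have h := IntervalIntegrable.sum (Finset.range L) fun i _ => hfl (a i) (b i)
    rwa [Finset.sum_fn] at h

/-- Bessel's inequality for a step function with two consecutive values. -/
theorem bessel_floorSum {L : ℕ} {c n : ℤ} {a b : ℕ → ℝ}
    (h : ∀ t, c + ∑ i ∈ Finset.range L, (⌊t - a i⌋ - ⌊t - b i⌋) = n ∨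
      c + ∑ i ∈ Finset.range L, (⌊t - a i⌋ - ⌊t - b i⌋) = n - 1) :
    ‖∑ i ∈ Finset.range L, (expTwoPi (a i) - expTwoPi (b i))‖ ^ 2 +
      ‖∑ i ∈ Finset.range L, (expTwoPi (2 * a i) - expTwoPi (2 * b i))‖ ^ 2 / 4 ≤
      Real.pi ^ 2 / 2 := by
  -- Centring the values at ±1/2 makes the squared norm 1/4 and leaves nonzero frequencies
  -- untouched.
  set u : ℝ → ℂ := fun t => (((c - n + 1 / 2 : ℝ) +
    (∑ i ∈ Finset.range L, (⌊t - a i⌋ - ⌊t - b i⌋) : ℤ) : ℝ) : ℂ) with hu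
  have hval : ∀ t, ‖u t‖ = 1 / 2 := by
    intro t
    rw [hu]
    dsimp only
    rw [Complex.norm_real, Real.norm_eq_abs]
    rcases h t with h | h
    · have : ((∑ i ∈ Finset.range L, (⌊t - a i⌋ - ⌊t - b i⌋) : ℤ) : ℝ) = n - c := by
        rw [← h]; push_cast; ring
      rw [this, show (c - n + 1 / 2 + (n - c) : ℝ) = 1 / 2 by ring]
      norm_num
    · have : ((∑ i ∈ Finset.range L, (⌊t - a i⌋ - ⌊t - b i⌋) : ℤ) : ℝ) = n - c - 1 := by
        have h' : (c : ℝ) + ((∑ i ∈ Finset.range L, (⌊t - a i⌋ - ⌊t - b i⌋) : ℤ) : ℝ) = n - 1 := by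
          exact_mod_cast h
        linarith
      rw [this, show (c - n + 1 / 2 + (n - c - 1) : ℝ) = -(1 / 2) by ring, abs_neg]
      norm_num
  have hum : Measurable u := by
    have h1 : ∀ a : ℝ, Measurable fun t : ℝ => ⌊t - a⌋ := fun a =>
      Int.measurable_floor.comp (measurable_sub_const a)
    have h2 : Measurable fun t : ℝ => (∑ i ∈ Finset.range L, (⌊t - a i⌋ - ⌊t - b i⌋) : ℤ) :=
      Finset.measurable_fun_sum _ fun i _ => (h1 _).sub (h1 _)
    exact Complex.measurable_ofReal.comp
      (((measurable_from_top (f := fun z : ℤ => (z : ℝ))).comp h2).const_add _)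
  have hL2 : MemLp u 2 (volume.restrict (Ioc 0 1)) :=
    MemLp.of_bound hum.aestronglyMeasurable (1 / 2) (Eventually.of_forall fun t => (hval t).le)
  have hsum := hasSum_sq_fourierCoeffOn (f := u) (zero_lt_one (α := ℝ)) hL2
  have hcoef : ∀ k : ℤ, k ≠ 0 → ‖fourierCoeffOn (zero_lt_one (α := ℝ)) u k‖ ^ 2 =
      ‖∑ i ∈ Finset.range L, (expTwoPi (k * a i) - expTwoPi (k * b i))‖ ^ 2 /
        (4 * Real.pi ^ 2 * k ^ 2) := by
    intro k hk
    have e1 : fourierCoeffOn (zero_lt_one (α := ℝ)) u k =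
        ∫ t in (0 : ℝ)..1, u t * expTwoPi (((-k : ℤ) : ℝ) * t) := by
      rw [fourierCoeffOn_eq_integral]
      simp only [sub_zero, div_one, one_smul]
      refine intervalIntegral.integral_congr fun t _ => ?_
      rw [fourier_coe_apply, smul_eq_mul, mul_comm]
      congr 1
      rw [expTwoPi]
      congr 1
      push_cast
      ring
    rw [e1, hu, integral_floorSum (neg_ne_zero.2 hk), norm_mul, mul_pow, div_eq_mul_inv]
    congr 1
    · have e2 : ∑ i ∈ Finset.range L,
          (expTwoPi (((-k : ℤ) : ℝ) * b i) - expTwoPi (((-k : ℤ) : ℝ) * a i)) =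
          -(starRingEnd ℂ) (∑ i ∈ Finset.range L, (expTwoPi (k * a i) - expTwoPi (k * b i))) := by
        rw [map_sum, ← Finset.sum_neg_distrib]
        refine Finset.sum_congr rfl fun i _ => ?_
        rw [map_sub, ← expTwoPi_neg, ← expTwoPi_neg, neg_sub]
        push_cast
        simp only [neg_mul]
      rw [e2, norm_neg, Complex.norm_conj]
    · rw [norm_inv, inv_pow]
      congr 1
      simp only [norm_mul, Complex.norm_real, Complex.norm_I, Complex.norm_intCast, Complex.norm_ofNat,
        Real.norm_eq_abs, mul_pow, sq_abs]
      push_cast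
      ring
  -- Frequencies ±1 alone give a bound π²/2 ≈ 4.93, which a mean square of 4 does not violate; the
  -- term from ±2 raises that 4 to 5.
  have hle := sum_le_hasSum ({1, -1, 2, -2} : Finset ℤ) (fun i _ => sq_nonneg _) hsum
  have hI : (1 - 0 : ℝ)⁻¹ • ∫ t in (0 : ℝ)..1, ‖u t‖ ^ 2 = 1 / 4 := by
    simp_rw [hval]
    norm_num
  rw [hI, Finset.sum_insert (by decide), Finset.sum_insert (by decide),
    Finset.sum_insert (by decide), Finset.sum_singleton, hcoef 1 (by decide),
    hcoef (-1) (by decide), hcoef 2 (by decide), hcoef (-2) (by decide)] at hle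
  have hsymm : ∀ k : ℝ, ‖∑ i ∈ Finset.range L, (expTwoPi (-k * a i) - expTwoPi (-k * b i))‖ =
      ‖∑ i ∈ Finset.range L, (expTwoPi (k * a i) - expTwoPi (k * b i))‖ := by
    intro k
    rw [← Complex.norm_conj, map_sum]
    congr 1
    refine Finset.sum_congr rfl fun i _ => ?_
    rw [map_sub, ← expTwoPi_neg, ← expTwoPi_neg]
    simp only [neg_mul, neg_neg]
  push_cast at hle
  rw [hsymm 1, hsymm 2] at hle
  simp only [one_mul] at hle
  have hpi : 0 < Real.pi ^ 2 := by positivity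
  set X := ‖∑ i ∈ Finset.range L, (expTwoPi (a i) - expTwoPi (b i))‖ ^ 2
  set Y := ‖∑ i ∈ Finset.range L, (expTwoPi (2 * a i) - expTwoPi (2 * b i))‖ ^ 2
  have e : X / (4 * Real.pi ^ 2 * 1 ^ 2) + (X / (4 * Real.pi ^ 2 * (-1) ^ 2) +
      (Y / (4 * Real.pi ^ 2 * 2 ^ 2) + Y / (4 * Real.pi ^ 2 * (-2) ^ 2))) =
      (X + Y / 4) / (2 * Real.pi ^ 2) := by
    field_simp
    ring
  rw [e, div_le_iff₀ (by positivity)] at hle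
  linarith

/-! ### Folding reduces the number of jumps -/

theorem isFloorSum_of_sub_eq_int {L : ℕ} {f : ℝ → ℤ} {c : ℤ} {a b : ℕ → ℝ}
    (h : ∀ t, f t = c + ∑ i ∈ Finset.range (L + 1), (⌊t - a i⌋ - ⌊t - b i⌋)) {i j : ℕ}
    (hi : i < L + 1) (hj : j < L + 1) {k : ℤ} (hk : a i - b j = k) : IsFloorSum L f := by
  have hswap : ∀ (F : ℕ → ℤ) {i : ℕ}, i < L + 1 → ∑ l ∈ Finset.range (L + 1), F l =
      ∑ l ∈ Finset.range L, F (Equiv.swap i L l) + F i := by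
    intro F i hi
    rw [← Equiv.Perm.sum_comp (Equiv.swap i L) (Finset.range (L + 1)) F, Finset.sum_range_succ,
      Equiv.swap_apply_right]
    intro l hl
    have hl' : Equiv.swap i L l ≠ l := hl
    rw [Finset.coe_range, mem_Iio]
    by_contra hlt
    exact hl' (Equiv.swap_apply_of_ne_of_ne (by omega) (by omega))
  refine ⟨c - k, fun l => a (Equiv.swap i L l), fun l => b (Equiv.swap j L l), fun t => ?_⟩
  rw [h, Finset.sum_sub_distrib, hswap (fun l => ⌊t - a l⌋) hi, hswap (fun l => ⌊t - b l⌋) hj,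
    Finset.sum_sub_distrib, show t - a i = t - b j - k by rw [← hk]; ring, Int.floor_sub_intCast]
  ring

/-- Averaged over N, both squares tend to limits at least 2(L + 1) ≥ 4. Excluding integer values of
2(a i - b j) separates opposite signs for the doubled frequencies as well. -/
theorem not_forall_le_of_no_common_jump {L : ℕ} (hL : 1 ≤ L) {a b : ℕ → ℝ}
    (hab : ∀ i < L + 1, ∀ j < L + 1, ∀ k : ℤ, 2 * (a i - b j) ≠ k) :
    ¬ ∀ N : ℕ, 0 < N →
      ‖∑ i ∈ Finset.range (L + 1), (expTwoPi (N * a i) - expTwoPi (N * b i))‖ ^ 2 +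
        ‖∑ i ∈ Finset.range (L + 1),
          (expTwoPi (2 * (N * a i)) - expTwoPi (2 * (N * b i)))‖ ^ 2 / 4 ≤ Real.pi ^ 2 / 2 := by
  intro hN
  set ε : Fin (L + 1) ⊕ Fin (L + 1) → ℝ := Sum.elim 1 (-1)
  set x : Fin (L + 1) ⊕ Fin (L + 1) → ℝ := Sum.elim (fun i => a i) (fun i => b i)
  have hε : ∀ p, ε p = 1 ∨ ε p = -1 := by
    rintro (p | p)
    · left; rfl
    · right; rfl
  have hx2 : ∀ p q, ε p ≠ ε q → ∀ k : ℤ, 2 * (x p - x q) ≠ k := by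
    rintro (p | p) (q | q) hpq k
    · exact absurd rfl hpq
    · exact hab p p.2 q q.2 k
    · have := hab q q.2 p p.2 (-k)
      simp only [x, Sum.elim_inl, Sum.elim_inr]
      intro h
      refine this ?_
      push_cast
      linarith
    · exact absurd rfl hpq
  obtain ⟨A, hA, hAt⟩ := exists_tendsto_average_norm_sq ε x hε fun p q hpq k hk =>
    hx2 p q hpq (2 * k) (by rw [hk]; push_cast; ring)
  obtain ⟨B, hB, hBt⟩ := exists_tendsto_average_norm_sq ε (fun p => 2 * x p) hε fun p q hpq k hk =>
    hx2 p q hpq k (by rw [← hk]; ring)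
  have hcard : (4 : ℝ) ≤ Fintype.card (Fin (L + 1) ⊕ Fin (L + 1)) := by
    rw [Fintype.card_sum, Fintype.card_fin]
    exact_mod_cast (by omega : 4 ≤ L + 1 + (L + 1))
  have hD : ∀ r s : ℝ, ∑ p, (ε p : ℂ) * expTwoPi (r * (s * x p)) =
      ∑ i ∈ Finset.range (L + 1), (expTwoPi (s * (r * a i)) - expTwoPi (s * (r * b i))) := by
    intro r s
    rw [Fintype.sum_sum_type, Finset.sum_range, Finset.sum_sub_distrib]
    simp [ε, x, sub_eq_add_neg, mul_left_comm]
  have hle : ∀ K : ℕ, (K : ℝ)⁻¹ * ∑ n ∈ Finset.range K, ‖∑ p, (ε p : ℂ) * expTwoPi (n * x p)‖ ^ 2 +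
      ((K : ℝ)⁻¹ * ∑ n ∈ Finset.range K, ‖∑ p, (ε p : ℂ) * expTwoPi (n * (2 * x p))‖ ^ 2) / 4 ≤
      Real.pi ^ 2 / 2 := by
    intro K
    have h1 : ∀ n : ℕ, ‖∑ p, (ε p : ℂ) * expTwoPi (n * x p)‖ ^ 2 +
        ‖∑ p, (ε p : ℂ) * expTwoPi (n * (2 * x p))‖ ^ 2 / 4 ≤ Real.pi ^ 2 / 2 := by
      intro n
      have e1 := hD n 1
      simp only [one_mul] at e1
      rw [e1, hD n 2]
      -- The average starts at n = 0, where positive and negative terms cancel.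
      rcases Nat.eq_zero_or_pos n with rfl | hn
      · simp
        positivity
      · exact hN n hn
    have h2 : ∑ n ∈ Finset.range K, (‖∑ p, (ε p : ℂ) * expTwoPi (n * x p)‖ ^ 2 +
        ‖∑ p, (ε p : ℂ) * expTwoPi (n * (2 * x p))‖ ^ 2 / 4) ≤ K * (Real.pi ^ 2 / 2) := by
      simpa using Finset.sum_le_card_nsmul (Finset.range K) _ _ fun n _ => h1 n
    rw [mul_div_assoc, ← mul_add, Finset.sum_div, ← Finset.sum_add_distrib]
    rcases Nat.eq_zero_or_pos K with rfl | hK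
    · simp
      positivity
    · have hK' : (0 : ℝ) < K := by exact_mod_cast hK
      rwa [inv_mul_le_iff₀ hK']
  have hlim := le_of_tendsto' (hAt.add (hBt.div_const 4)) hle
  -- The limit is at least 4 + 4/4 = 5, whereas π < 3.15 gives π²/2 < 4.97.
  nlinarith [Real.pi_lt_d2, Real.pi_pos]

theorem IsFloorSum.exists_reducing_fold {L : ℕ} (hL : 1 ≤ L) {f : ℝ → ℤ}
    (hf : IsFloorSum (L + 1) f) :
    ∃ N : ℕ, 0 < N ∧ ∀ n : ℤ,
      IsFloorSum L fun t => if n ≤ ∑ j ∈ Finset.range N, f ((t + j) / N) then 1 else 0 := by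
  obtain ⟨c, a, b, hf⟩ := hf
  by_cases hab : ∃ i < L + 1, ∃ j < L + 1, ∃ k : ℤ, 2 * (a i - b j) = k
  · obtain ⟨i, hi, j, hj, k, hk⟩ := hab
    refine ⟨2, two_pos, fun n => ?_⟩
    refine IsFloorSum.superlevel_same (f := fun t => ∑ j ∈ Finset.range 2, f ((t + j) / (2 : ℕ))) ?_ n
    refine isFloorSum_of_sub_eq_int (fun t => floorSum_fold two_pos hf t) hi hj (k := k) ?_
    rw [← hk]
    push_cast
    ring
  · push Not at hab
    have hno := not_forall_le_of_no_common_jump hL hab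
    push Not at hno
    obtain ⟨N, hN, hlt⟩ := hno
    refine ⟨N, hN, fun n => ?_⟩
    have hfold := fun t => floorSum_fold hN hf t
    have hF : IsFloorSum (L + 1) fun t => ∑ j ∈ Finset.range N, f ((t + j) / N) :=
      ⟨_, _, _, hfold⟩
    refine (hF.superlevel n).resolve_right fun h2 => hlt.not_ge ?_
    exact bessel_floorSum (c := N * c) (n := n) fun t => by rw [← hfold]; exact h2 t

/-! ### The space of functions with prescribed spectrum -/

/-- The closed subspace of `L²` of functions whose spectrum is contained in `Λ`. -/
noncomputable def spectralSubspace (Λ : Set ℤ) :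
    Submodule ℂ (Lp ℂ 2 (haarAddCircle : Measure UnitAddCircle)) where
  carrier := {g | ∀ n ∉ Λ, fourierBasis.repr g n = 0}
  zero_mem' := fun n _ => by simp
  add_mem' := fun hf hg n hn => by simp [hf n hn, hg n hn]
  smul_mem' := fun c f hf n hn => by simp [hf n hn]

theorem mem_spectralSubspace {Λ : Set ℤ}
    {g : Lp ℂ 2 (haarAddCircle : Measure UnitAddCircle)} :
    g ∈ spectralSubspace Λ ↔ ∀ n ∉ Λ, fourierBasis.repr g n = 0 := Iff.rfl

theorem toLp_mem_spectralSubspace {Λ : Set ℤ} {g : UnitAddCircle → ℂ} (hg : HasSpectrumIn Λ g) :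
    hg.1.toLp ∈ spectralSubspace Λ := fun n hn => by
  rw [← fourierCoeff_eq_repr, hg.2 n hn]

theorem hasSpectrumIn_of_mem {Λ : Set ℤ} {g : Lp ℂ 2 (haarAddCircle : Measure UnitAddCircle)}
    (hg : g ∈ spectralSubspace Λ) : HasSpectrumIn Λ g :=
  ⟨Lp.memLp g, fun n hn => by rw [← fourierBasis_repr]; exact hg n hn⟩

instance completeSpace_spectralSubspace (Λ : Set ℤ) : CompleteSpace (spectralSubspace Λ) := by
  refine IsClosed.completeSpace_coe (hs := ?_)
  have : (spectralSubspace Λ : Set (Lp ℂ 2 (haarAddCircle : Measure UnitAddCircle))) =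
      ⋂ n ∈ Λᶜ, {g | inner ℂ (fourierBasis n) g = 0} := by
    ext g
    simp only [SetLike.mem_coe, mem_spectralSubspace, mem_iInter, mem_compl_iff,
      mem_ofPred_eq, HilbertBasis.repr_apply_apply]
  rw [this]
  exact isClosed_biInter fun n _ =>
    isClosed_eq (continuous_const.inner continuous_id) continuous_const

/-- The unimodular factors leave room for normalising the characters at the endpoint of an arc. -/
theorem exists_hilbertBasis_spectralSubspace {ι : Type*} {Λ : Set ℤ} (e : ι → ℤ)
    (he : Function.Injective e) (hr : range e = Λ) (c : ι → ℂ) (hc : ∀ i, ‖c i‖ = 1) :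
    ∃ b : HilbertBasis ι ℂ (spectralSubspace Λ), ∀ i,
      (b i : Lp ℂ 2 (haarAddCircle : Measure UnitAddCircle)) = c i • fourierBasis (e i) := by
  classical
  have hmem : ∀ i, c i • fourierBasis (T := 1) (e i) ∈ spectralSubspace Λ := by
    intro i n hn
    have : e i ≠ n := by rintro rfl; exact hn (hr ▸ mem_range_self i)
    rw [map_smul, HilbertBasis.repr_self]
    simp [lp.single_apply, this.symm]
  set v : ι → spectralSubspace Λ := fun i => ⟨_, hmem i⟩
  have hv : Orthonormal ℂ v := by
    rw [orthonormal_iff_ite]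
    intro i j
    have h := orthonormal_iff_ite.1 (fourierBasis (T := 1)).orthonormal (e i) (e j)
    change inner ℂ (c i • fourierBasis (T := 1) (e i)) (c j • fourierBasis (e j)) = _
    rw [inner_smul_left, inner_smul_right, h]
    simp only [he.eq_iff]
    split_ifs with hij
    · rw [hij, mul_one, Complex.conj_mul', hc]
      norm_num
    · simp
  refine ⟨HilbertBasis.mkOfOrthogonalEqBot hv ?_, fun i => ?_⟩
  · rw [Submodule.eq_bot_iff]
    intro g hg
    have h0 : ∀ i, inner ℂ (v i) g = 0 := fun i =>
      (Submodule.mem_orthogonal _ _).1 hg _ (Submodule.subset_span (mem_range_self i))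
    refine Subtype.ext (fourierBasis.repr.injective (lp.ext (funext fun n => ?_)))
    by_cases hn : n ∈ Λ
    · obtain ⟨i, rfl⟩ : n ∈ range e := hr ▸ hn
      have h1 : inner ℂ (c i • fourierBasis (T := 1) (e i)) (g : Lp ℂ 2 haarAddCircle) = 0 := h0 i
      rw [inner_smul_left, mul_eq_zero] at h1
      have h2 := h1.resolve_left (by
        intro h
        rw [map_eq_zero] at h
        have := hc i
        rw [h, norm_zero] at this
        exact zero_ne_one this)
      rw [HilbertBasis.repr_apply_apply, h2]
      simp
    · rw [g.2 n hn]
      simp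
  · rw [HilbertBasis.coe_mkOfOrthogonalEqBot]

/-- Only the kernel of Z matters, so restriction to S may be followed by a change of variable. -/
theorem isRieszSpectrum_of_injective_surjective {X : Type*} [MeasurableSpace X] {ν : Measure X}
    {Λ : Set ℤ} {S : Set UnitAddCircle}
    (Z : Lp ℂ 2 (haarAddCircle : Measure UnitAddCircle) →L[ℂ] Lp ℂ 2 ν)
    (hZ : ∀ g, Z g = 0 ↔ ∀ᵐ x ∂haarAddCircle, x ∈ S → g x = 0)
    (h : Function.Bijective (Z.comp (spectralSubspace Λ).subtypeL)) : IsRieszSpectrum Λ S := by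
  constructor
  · intro G hG
    obtain ⟨g, hg⟩ := h.2 (Z hG.toLp)
    refine ⟨_, hasSpectrumIn_of_mem g.2, ?_⟩
    have h0 : Z ((g : Lp ℂ 2 haarAddCircle) - hG.toLp) = 0 := by
      rw [map_sub, sub_eq_zero]; exact hg
    filter_upwards [(hZ _).1 h0, Lp.coeFn_sub (g : Lp ℂ 2 haarAddCircle) hG.toLp,
      hG.coeFn_toLp] with x h1 h2 h3 hx
    have h4 := h1 hx
    rw [h2, Pi.sub_apply, h3, sub_eq_zero] at h4
    exact h4
  · intro g hg h0
    have h1 : Z hg.1.toLp = 0 := by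
      rw [hZ]
      filter_upwards [h0, hg.1.coeFn_toLp] with x hx hx2 hxS
      rw [hx2, hx hxS]
    have h2 : (⟨hg.1.toLp, toLp_mem_spectralSubspace hg⟩ : spectralSubspace Λ) = 0 :=
      h.1 (by simpa using h1)
    have h3 : hg.1.toLp = 0 := congrArg Subtype.val h2
    exact hg.1.coeFn_toLp.symm.trans (by rw [h3]; exact Lp.coeFn_zero _ _ _)

theorem IsRieszSpectrum.bijective {X : Type*} [MeasurableSpace X] {ν : Measure X}
    {Λ : Set ℤ} {S : Set UnitAddCircle} (h : IsRieszSpectrum Λ S)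
    (Z : Lp ℂ 2 (haarAddCircle : Measure UnitAddCircle) →L[ℂ] Lp ℂ 2 ν)
    (hZ : ∀ g, Z g = 0 ↔ ∀ᵐ x ∂haarAddCircle, x ∈ S → g x = 0)
    (hs : Function.Surjective Z) :
    Function.Bijective (Z.comp (spectralSubspace Λ).subtypeL) := by
  constructor
  · rw [injective_iff_map_eq_zero]
    intro g hg
    have h0 := h.2 _ (hasSpectrumIn_of_mem g.2) ((hZ g).1 hg)
    exact Subtype.ext (Lp.ext (h0.trans (Lp.coeFn_zero ℂ 2 haarAddCircle).symm))
  · intro F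
    obtain ⟨G, rfl⟩ := hs F
    obtain ⟨g, hg, hgG⟩ := h.1 G (Lp.memLp G)
    refine ⟨⟨_, toLp_mem_spectralSubspace hg⟩, ?_⟩
    change Z hg.1.toLp = Z G
    rw [← sub_eq_zero, ← map_sub, hZ]
    filter_upwards [hgG, hg.1.coeFn_toLp, Lp.coeFn_sub hg.1.toLp G] with x h1 h2 h3 hx
    rw [h3, Pi.sub_apply, h2, h1 hx, sub_self]

/-! ### Perturbation of the trigonometric system -/

theorem bijective_of_near_isometryEquiv {H K : Type*} [NormedAddCommGroup H]
    [InnerProductSpace ℂ H] [NormedAddCommGroup K] [InnerProductSpace ℂ K] [CompleteSpace K]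
    (U : H ≃ₗᵢ[ℂ] K) (W : H →L[ℂ] K) {q : ℝ} (hq0 : 0 ≤ q) (hq : q < 1)
    (h : ∀ v, ‖W v - U v‖ ≤ q * ‖v‖) :
    Function.Bijective W := by
  set X : K →L[ℂ] K := 1 - W.comp (U.symm.toContinuousLinearEquiv : K →L[ℂ] H)
  have hX : ‖X‖ ≤ q := by
    refine ContinuousLinearMap.opNorm_le_bound _ hq0 fun v => ?_
    have h1 := h (U.symm v)
    rw [U.apply_symm_apply, U.symm.norm_map, norm_sub_rev] at h1
    exact h1
  have hu := isUnit_one_sub_of_norm_lt_one (hX.trans_lt hq)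
  have hb := ContinuousLinearMap.isUnit_iff_bijective.1 hu
  have e : (W : H → K) = (1 - X : K →L[ℂ] K) ∘ U := by
    ext v
    simp [X]
  rw [e]
  exact hb.comp U.bijective

theorem norm_sq_toLp {F : UnitAddCircle → ℂ} (hF : MemLp F 2 haarAddCircle) :
    ‖hF.toLp‖ ^ 2 = ∫ y, ‖F y‖ ^ 2 ∂haarAddCircle := by
  have h := tsum_sq_fourierCoeff hF.toLp
  have h2 := (fourierBasis (T := 1)).repr.norm_map hF.toLp
  have h3 := lp.norm_rpow_eq_tsum (p := 2) (by norm_num) (fourierBasis.repr hF.toLp)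
  rw [h2] at h3
  simp only [ENNReal.toReal_ofNat, Real.rpow_ofNat, fourierBasis_repr] at h3
  rw [h3, h]
  refine integral_congr_ae ?_
  filter_upwards [hF.coeFn_toLp] with y hy
  rw [hy]

theorem memLp_of_continuous {F : UnitAddCircle → ℂ} (hF : Continuous F) :
    MemLp F 2 haarAddCircle :=
  MemLp.of_bound hF.aestronglyMeasurable ‖(⟨F, hF⟩ : C(UnitAddCircle, ℂ))‖
    (Eventually.of_forall fun y => ContinuousMap.norm_coe_le_norm ⟨F, hF⟩ y)

theorem norm_sq_sum_smul_fourierBasis (s : Finset ℤ) (a : ℤ → ℂ) :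
    ‖∑ k ∈ s, a k • fourierBasis (T := 1) k‖ ^ 2 = ∑ k ∈ s, ‖a k‖ ^ 2 := by
  simpa using (fourierBasis (T := 1)).orthonormal.orthogonalFamily.norm_sum a s

theorem integral_norm_sq_trigSum (s : Finset ℤ) (a : ℤ → ℂ) :
    ∫ y : UnitAddCircle, ‖∑ k ∈ s, a k * fourier k y‖ ^ 2 ∂haarAddCircle = ∑ k ∈ s, ‖a k‖ ^ 2 := by
  have hc : Continuous fun y : UnitAddCircle => ∑ k ∈ s, a k * fourier k y := by fun_prop
  rw [← norm_sq_toLp (memLp_of_continuous hc), ← norm_sq_sum_smul_fourierBasis]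
  congr 2
  refine Lp.ext ?_
  refine (memLp_of_continuous hc).coeFn_toLp.trans ?_
  have h1 := Lp.coeFn_finsetSum s fun k => a k • fourierBasis (T := 1) k
  have h2 : ∀ᵐ y ∂(haarAddCircle : Measure UnitAddCircle), ∀ k : ℤ,
      (a k • fourierBasis (T := 1) k : Lp ℂ 2 haarAddCircle) y = a k * fourier k y :=
    ae_all_iff.2 fun k => by
      filter_upwards [Lp.coeFn_smul (a k) (fourierBasis (T := 1) k),
        coeFn_fourierLp (T := 1) 2 k] with y h3 h4
      rw [h3, Pi.smul_apply, coe_fourierBasis, h4, smul_eq_mul]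
  filter_upwards [h1, h2] with y h3 h4
  rw [h3, Finset.sum_apply]
  exact Finset.sum_congr rfl fun k _ => (h4 k).symm

theorem sq_integral_le_integral_sq {g : ℝ → ℝ} (hg : Continuous g) :
    (∫ t in (0 : ℝ)..1, g t) ^ 2 ≤ ∫ t in (0 : ℝ)..1, g t ^ 2 := by
  set m := ∫ t in (0 : ℝ)..1, g t
  have h1 : 0 ≤ ∫ t in (0 : ℝ)..1, (g t - m) ^ 2 :=
    intervalIntegral.integral_nonneg zero_le_one fun t _ => sq_nonneg _
  have h2 : ∫ t in (0 : ℝ)..1, (g t - m) ^ 2 =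
      (∫ t in (0 : ℝ)..1, g t ^ 2) - (∫ t in (0 : ℝ)..1, 2 * m * g t) +
        ∫ t in (0 : ℝ)..1, m ^ 2 := by
    rw [← intervalIntegral.integral_sub (Continuous.intervalIntegrable (by fun_prop) _ _)
      (Continuous.intervalIntegrable (by fun_prop) _ _), ← intervalIntegral.integral_add
      (Continuous.intervalIntegrable (by fun_prop) _ _)
      (Continuous.intervalIntegrable (by fun_prop) _ _)]
    refine intervalIntegral.integral_congr fun t _ => ?_
    ring
  rw [h2, intervalIntegral.integral_const_mul, intervalIntegral.integral_const] at h1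
  simp only [sub_zero, one_smul] at h1
  change 0 ≤ _ - 2 * m * m + m ^ 2 at h1
  linarith

/-- Integrate the derivative over [0, ρ], enlarge to [0, 1] and use Cauchy–Schwarz. The bound no
longer involves ρ, so ρ may later depend on the point of the circle. -/
theorem norm_sq_sum_expTwoPi_sub_one_le (s : Finset ℤ) (d : ℤ → ℝ) (a : ℤ → ℂ) {ρ : ℝ}
    (hρ : ρ ∈ Ioc (0 : ℝ) 1) :
    ‖∑ k ∈ s, a k * (expTwoPi (d k * ρ) - 1)‖ ^ 2 ≤
      (2 * Real.pi) ^ 2 * ∫ r in (0 : ℝ)..1, ‖∑ k ∈ s, a k * d k * expTwoPi (d k * r)‖ ^ 2 := by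
  set Φ : ℝ → ℂ := fun r => ∑ k ∈ s, a k * d k * expTwoPi (d k * r) with hΦ
  have hΦc : Continuous Φ := by fun_prop
  have hd : ∀ r : ℝ, HasDerivAt (fun r : ℝ => ∑ k ∈ s, a k * expTwoPi (d k * r))
      (2 * Real.pi * Complex.I * Φ r) r := by
    intro r
    have h1 : ∀ k ∈ s, HasDerivAt (fun r : ℝ => a k * expTwoPi (d k * r))
        (a k * (expTwoPi (d k * r) * (2 * Real.pi * Complex.I * d k))) r := by
      intro k _
      refine HasDerivAt.const_mul _ ?_
      have h2 : HasDerivAt (fun r : ℝ => 2 * Real.pi * Complex.I * ((d k * r : ℝ) : ℂ))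
          (2 * Real.pi * Complex.I * d k) r := by
        refine HasDerivAt.const_mul _ ?_
        have := ((hasDerivAt_id r).const_mul (d k)).ofReal_comp
        simpa using this
      exact h2.cexp
    refine (HasDerivAt.fun_sum h1).congr_deriv ?_
    rw [hΦ, Finset.mul_sum]
    exact Finset.sum_congr rfl fun k _ => by ring
  have h0 : expTwoPi 0 = 1 := by simpa using expTwoPi_int 0
  have hI : ∑ k ∈ s, a k * (expTwoPi (d k * ρ) - 1) =
      ∫ r in (0 : ℝ)..ρ, 2 * Real.pi * Complex.I * Φ r := by
    rw [intervalIntegral.integral_eq_sub_of_hasDerivAt (fun r _ => hd r)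
      (Continuous.intervalIntegrable (by fun_prop) _ _), ← Finset.sum_sub_distrib]
    refine Finset.sum_congr rfl fun k _ => ?_
    rw [mul_zero, h0]
    ring
  have h2 : ‖∑ k ∈ s, a k * (expTwoPi (d k * ρ) - 1)‖ ≤
      2 * Real.pi * ∫ r in (0 : ℝ)..1, ‖Φ r‖ := by
    rw [hI, intervalIntegral.integral_const_mul, norm_mul]
    have e : ‖(2 * Real.pi * Complex.I : ℂ)‖ = 2 * Real.pi := by
      simp [abs_of_pos Real.pi_pos]
    rw [e]
    refine mul_le_mul_of_nonneg_left ?_ (by positivity)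
    refine (intervalIntegral.norm_integral_le_integral_norm hρ.1.le).trans ?_
    refine intervalIntegral.integral_mono_interval le_rfl hρ.1.le hρ.2
      (Eventually.of_forall fun r => norm_nonneg _) (hΦc.norm.intervalIntegrable _ _)
  calc _ ≤ (2 * Real.pi * ∫ r in (0 : ℝ)..1, ‖Φ r‖) ^ 2 := by gcongr
    _ = (2 * Real.pi) ^ 2 * (∫ r in (0 : ℝ)..1, ‖Φ r‖) ^ 2 := by ring
    _ ≤ _ := by
      gcongr
      exact sq_integral_le_integral_sq hΦc.norm

/-- A Paley–Wiener type estimate: after exchanging the integrals, each fixed r leaves a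
trigonometric sum in y with coefficients c k * d k times a unimodular factor, and Parseval evaluates
its norm. -/
theorem integral_norm_sq_perturbation_le (s : Finset ℤ) (d : ℤ → ℝ) (c : ℤ → ℂ) {η : ℝ}
    (hd : ∀ k, |d k| ≤ η) :
    ∫ y : UnitAddCircle, ‖∑ k ∈ s, c k * fourier k y * (expTwoPi (d k * circleRep 0 y) - 1)‖ ^ 2
      ∂haarAddCircle ≤ (2 * Real.pi * η) ^ 2 * ∑ k ∈ s, ‖c k‖ ^ 2 := by
  set Ψ : UnitAddCircle → ℝ → ℝ := fun y r =>
    ‖∑ k ∈ s, c k * fourier k y * d k * expTwoPi (d k * r)‖ ^ 2 with hΨ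
  have hΨc : Continuous (Function.uncurry Ψ) := by
    unfold Function.uncurry
    fun_prop
  have hΨb : ∀ y r, Ψ y r ≤ (∑ k ∈ s, ‖c k‖ * |d k|) ^ 2 := by
    intro y r
    rw [hΨ]
    dsimp only
    gcongr
    refine (norm_sum_le _ _).trans (Finset.sum_le_sum fun k _ => ?_)
    rw [norm_mul, norm_mul, norm_mul, norm_fourier_apply, norm_expTwoPi, Complex.norm_real,
      Real.norm_eq_abs, mul_one, mul_one]
  have hint : Integrable (Function.uncurry Ψ)
      ((haarAddCircle : Measure UnitAddCircle).prod (volume.restrict (Ioc (0 : ℝ) 1))) := by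
    refine Integrable.of_bound hΨc.aestronglyMeasurable ((∑ k ∈ s, ‖c k‖ * |d k|) ^ 2)
      (Eventually.of_forall fun z => ?_)
    change ‖Ψ z.1 z.2‖ ≤ _
    rw [Real.norm_of_nonneg (show 0 ≤ Ψ z.1 z.2 from sq_nonneg _)]
    exact hΨb _ _
  have hmeas : Measurable fun y : UnitAddCircle =>
      ∑ k ∈ s, c k * fourier k y * (expTwoPi (d k * circleRep 0 y) - 1) := by
    have h1 := (measurableEmbedding_circleRep 0).measurable
    refine Finset.measurable_fun_sum _ fun k _ => ?_
    refine Measurable.mul (by fun_prop) (Measurable.sub_const ?_ _)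
    exact continuous_expTwoPi.measurable.comp (h1.const_mul _)
  have hle : ∫ y : UnitAddCircle,
      ‖∑ k ∈ s, c k * fourier k y * (expTwoPi (d k * circleRep 0 y) - 1)‖ ^ 2 ∂haarAddCircle ≤
      ∫ y : UnitAddCircle, (2 * Real.pi) ^ 2 * (∫ r in Ioc (0 : ℝ) 1, Ψ y r) ∂haarAddCircle := by
    refine integral_mono_of_nonneg (Eventually.of_forall fun y => sq_nonneg _)
      (hint.integral_prod_left.const_mul _) (Eventually.of_forall fun y => ?_)
    have h := norm_sq_sum_expTwoPi_sub_one_le s d (fun k => c k * fourier k y)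
      (by simpa using circleRep_mem 0 y)
    rwa [intervalIntegral.integral_of_le zero_le_one] at h
  refine hle.trans ?_
  rw [integral_const_mul, integral_integral_swap hint, mul_pow (2 * Real.pi), mul_assoc]
  refine mul_le_mul_of_nonneg_left ?_ (by positivity)
  have hin : ∀ r, ∫ y, Ψ y r ∂haarAddCircle = ∑ k ∈ s, ‖c k‖ ^ 2 * |d k| ^ 2 := by
    intro r
    have h := integral_norm_sq_trigSum s fun k => c k * d k * expTwoPi (d k * r)
    simp_rw [norm_mul, norm_expTwoPi, Complex.norm_real, Real.norm_eq_abs, mul_one, mul_pow] at h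
    rw [← h]
    refine integral_congr_ae (Eventually.of_forall fun y => ?_)
    simp only [hΨ]
    congr 2
    exact Finset.sum_congr rfl fun k _ => by ring
  simp_rw [hin]
  rw [← intervalIntegral.integral_of_le zero_le_one, intervalIntegral.integral_const, sub_zero,
    one_smul, Finset.mul_sum]
  refine Finset.sum_le_sum fun k _ => ?_
  rw [mul_comm]
  have := hd k
  gcongr

/-! ### Short arcs -/

theorem norm_sq_Lp (F : Lp ℂ 2 (haarAddCircle : Measure UnitAddCircle)) :
    ‖F‖ ^ 2 = ∫ y, ‖F y‖ ^ 2 ∂haarAddCircle := by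
  have h := norm_sq_toLp (Lp.memLp F)
  rwa [Lp.toLp_coeFn] at h

theorem fourierBasis_coeFn (k : ℤ) :
    (fourierBasis (T := 1) k : Lp ℂ 2 haarAddCircle) =ᵐ[haarAddCircle] fourier k := by
  rw [coe_fourierBasis]
  exact coeFn_fourierLp 2 k

theorem fourier_coe_eq_expTwoPi (k : ℤ) (t : ℝ) :
    fourier k (t : UnitAddCircle) = expTwoPi (k * t) := by
  rw [fourier_coe_apply, expTwoPi]
  congr 1
  push_cast
  ring

/-- Rounding k/δ to an integer moves the frequency, after rescaling the arc to length 1, by at most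
δ/2. Restriction is then within 2π · δ/2 = πδ ≤ π/4 < 1 of a unitary. -/
theorem exists_isRieszSpectrum_arc {p δ : ℝ} (hδ : 0 < δ) (hδ' : δ ≤ 1 / 4)
    {S : Set UnitAddCircle} (hS : ∀ t : ℝ, (t : UnitAddCircle) ∈ S ↔ Int.fract (t - p) < δ) :
    ∃ Λ, IsRieszSpectrum Λ S := by
  set n : ℤ → ℤ := fun k => round (k / δ)
  set d : ℤ → ℝ := fun k => n k * δ - k with hd
  have hdle : ∀ k, |d k| ≤ δ / 2 := by
    intro k
    have h := abs_sub_round ((k : ℝ) / δ)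
    have e : d k = -((k / δ - n k) * δ) := by
      simp only [hd]
      field_simp
      ring
    rw [e, abs_neg, abs_mul, abs_of_pos hδ]
    nlinarith
  have hinj : Function.Injective n := by
    intro k l hkl
    have h1 := abs_le.1 (hdle k)
    have h2 := abs_le.1 (hdle l)
    simp only [hd, hkl] at h1 h2
    have h3 : |((k - l : ℤ) : ℝ)| < 1 := by
      rw [abs_lt]
      push_cast
      constructor <;> linarith
    have h4 : |k - l| < 1 := by exact_mod_cast h3
    rw [Int.abs_lt_one_iff] at h4
    omega
  -- With this phase, b k read at p + δs is e(n k · δs) = e(ks) e(d k · s), a perturbed character.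
  obtain ⟨b, hb⟩ := exists_hilbertBasis_spectralSubspace n hinj rfl
    (fun k => expTwoPi (-(n k * p))) fun k => norm_expTwoPi _
  obtain ⟨Z, hZ⟩ := exists_compLp (measurable_branch p δ) ENNReal.ofReal_ne_top
    (map_branch_le hδ (by linarith) p)
  refine ⟨range n, isRieszSpectrum_of_injective_surjective Z (fun g => ?_) ?_⟩
  · have h1 : Z g = 0 ↔ ∀ᵐ y ∂haarAddCircle, g (branch p δ y) = 0 := by
      rw [Lp.eq_zero_iff_ae_eq_zero]
      constructor
      · intro h
        filter_upwards [h, hZ g] with y h1 h2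
        rw [← h2, h1]
        rfl
      · intro h
        filter_upwards [h, hZ g] with y h1 h2
        rw [h2, h1]
        rfl
    rw [h1, ae_branch_iff hδ p (P := fun x => g x = 0), ae_circle_iff_Ioc p]
    have hne : ∀ᵐ t : ℝ, t ≠ p + δ ∧ t ≠ p + 1 := by
      refine Eventually.and ?_ ?_ <;> simp [ae_iff]
    refine ⟨fun h => ?_, fun h => ?_⟩
    · filter_upwards [h, hne] with t ht hne h1 h2
      rw [hS, Int.fract_eq_self.2
        ⟨by linarith [h1.1], by linarith [lt_of_le_of_ne h1.2 hne.2]⟩] at h2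
      exact ht ⟨h1.1, by linarith⟩
    · filter_upwards [h, hne] with t ht hne h1
      refine ht ⟨h1.1, by linarith [h1.2]⟩ ?_
      have h3 := lt_of_le_of_ne h1.2 hne.1
      rw [hS, Int.fract_eq_self.2 ⟨by linarith [h1.1], by linarith⟩]
      linarith
  · set W := Z.comp (spectralSubspace (range n)).subtypeL
    set U : spectralSubspace (range n) ≃ₗᵢ[ℂ] Lp ℂ 2 (haarAddCircle : Measure UnitAddCircle) :=
      b.repr.trans fourierBasis.repr.symm with hU
    have hUb : ∀ k, U (b k) = fourierBasis k := by
      classical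
      intro k
      rw [hU, LinearIsometryEquiv.trans_apply, b.repr_self, HilbertBasis.repr_symm_single]
    have hWb : ∀ k, W (b k) =ᵐ[haarAddCircle] fun y =>
        fourier k y * expTwoPi (d k * circleRep 0 y) := by
      intro k
      have h1 := Lp.coeFn_smul (expTwoPi (-(n k * p))) (fourierBasis (T := 1) (n k))
      rw [← hb] at h1
      filter_upwards [hZ (b k), ae_of_ae_branch hδ p h1,
        ae_of_ae_branch hδ p (fourierBasis_coeFn (n k))] with y h2 h3 h4
      change Z (b k) y = _
      rw [h2, h3, Pi.smul_apply, h4, branch, fourier_coe_eq_expTwoPi, smul_eq_mul, ← expTwoPi_add]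
      conv_rhs => rw [← coe_circleRep 0 y, fourier_coe_eq_expTwoPi, coe_circleRep, ← expTwoPi_add]
      congr 1
      simp only [hd]
      ring
    have hfin : ∀ (s : Finset ℤ) (a : ℤ → ℂ), ‖W (∑ k ∈ s, a k • b k) - U (∑ k ∈ s, a k • b k)‖ ≤
        Real.pi * δ * ‖∑ k ∈ s, a k • b k‖ := by
      intro s a
      have hnorm : ‖∑ k ∈ s, a k • b k‖ ^ 2 = ∑ k ∈ s, ‖a k‖ ^ 2 := by
        simpa using b.orthonormal.orthogonalFamily.norm_sum a s
      refine (sq_le_sq₀ (norm_nonneg _) (by positivity)).1 ?_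
      rw [mul_pow, hnorm, norm_sq_Lp]
      have hη := integral_norm_sq_perturbation_le s d a hdle
      rw [show 2 * Real.pi * (δ / 2) = Real.pi * δ by ring] at hη
      refine le_trans (le_of_eq (integral_congr_ae ?_)) hη
      have e : W (∑ k ∈ s, a k • b k) - U (∑ k ∈ s, a k • b k) =
          ∑ k ∈ s, a k • (W (b k) - fourierBasis k) := by
        simp only [map_sum, map_smul, hUb, smul_sub, Finset.sum_sub_distrib]
      rw [e]
      have h2 : ∀ᵐ y ∂(haarAddCircle : Measure UnitAddCircle), ∀ k : ℤ,
          (a k • (W (b k) - fourierBasis k) : Lp ℂ 2 haarAddCircle) y =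
            a k * fourier k y * (expTwoPi (d k * circleRep 0 y) - 1) :=
        ae_all_iff.2 fun k => by
          filter_upwards [Lp.coeFn_smul (a k) (W (b k) - fourierBasis k),
            Lp.coeFn_sub (W (b k)) (fourierBasis k), hWb k, fourierBasis_coeFn k] with y h3 h4 h5 h6
          rw [h3, Pi.smul_apply, h4, Pi.sub_apply, h5, h6, smul_eq_mul]
          ring
      filter_upwards [Lp.coeFn_finsetSum s fun k => a k • (W (b k) - fourierBasis k), h2]
        with y h3 h4
      rw [h3, Finset.sum_apply, Finset.sum_congr rfl fun k _ => h4 k]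
    refine bijective_of_near_isometryEquiv U W (q := Real.pi * δ) (by positivity)
      (by nlinarith [Real.pi_lt_four]) fun v => ?_
    have hcl : IsClosed {v | ‖W v - U v‖ ≤ Real.pi * δ * ‖v‖} :=
      isClosed_le ((W.continuous.sub U.continuous).norm) (continuous_const.mul continuous_norm)
    exact hcl.mem_of_tendsto (b.hasSum_repr v) (Eventually.of_forall fun s => hfin s _)

/-! ### Sets with finitely many jumps -/

open Classical in
/-- The indicator function of a set of points of the circle, as a periodic function. -/
noncomputable def circleIndicator (S : Set UnitAddCircle) (t : ℝ) : ℤ :=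
  if (t : UnitAddCircle) ∈ S then 1 else 0

theorem coe_eq_coe_iff_exists_int {s t : ℝ} :
    (t : UnitAddCircle) = s ↔ ∃ m : ℤ, t = s + m := by
  rw [← sub_eq_zero, ← AddCircle.coe_sub, AddCircle.coe_eq_zero_iff]
  refine exists_congr fun m => ?_
  rw [zsmul_one, eq_comm, sub_eq_iff_eq_add']

theorem circleIndicator_periodic (S : Set UnitAddCircle) :
    Function.Periodic (circleIndicator S) 1 := fun t => by
  rw [circleIndicator, circleIndicator, AddCircle.coe_add_period]

theorem measurableSet_of_isFloorSum {L : ℕ} {S : Set UnitAddCircle}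
    (h : IsFloorSum L (circleIndicator S)) : MeasurableSet S := by
  obtain ⟨c, a, b, h⟩ := h
  have h1 : ∀ a : ℝ, Measurable fun t : ℝ => ⌊t - a⌋ := fun a =>
    Int.measurable_floor.comp (measurable_sub_const a)
  have h2 : Measurable (circleIndicator S) := by
    rw [funext h]
    exact (Finset.measurable_fun_sum _ fun i _ => (h1 _).sub (h1 _)).const_add _
  have h3 : S = circleRep 0 ⁻¹' (circleIndicator S ⁻¹' {1}) := by
    ext x
    simp [circleIndicator]
  rw [h3]
  exact (measurableEmbedding_circleRep 0).measurable (h2 (measurableSet_singleton 1))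

/-- Links spectra to step functions. "More than n points" is level n + 1 of the fold, and
1-periodicity of the fold allows t to be replaced by its representative in (0, 1]. -/
theorem circleIndicator_fibre {N : ℕ} (hN : 0 < N) (S : Set UnitAddCircle) (n : ℕ) (t : ℝ) :
    circleIndicator {y | n < (fibreIdx N S y).card} t =
      if ((n : ℤ) + 1) ≤ ∑ j ∈ Finset.range N, circleIndicator S ((t + j) / N) then 1 else 0 := by
  have hN' : (N : ℝ) ≠ 0 := by positivity
  set g : ℝ → ℤ := fun t => ∑ j ∈ Finset.range N, circleIndicator S ((t + j) / N) with hg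
  have hper : Function.Periodic g 1 := by
    intro t
    have h1 := Finset.sum_range_succ (fun j : ℕ => circleIndicator S ((t + j) / N)) N
    rw [Finset.sum_range_succ'] at h1
    have h2 : circleIndicator S ((t + N) / N) = circleIndicator S ((t + (0 : ℕ)) / N) := by
      rw [add_div, div_self hN', circleIndicator_periodic]
      simp
    rw [h2] at h1
    have h3 := add_right_cancel h1
    simp only [hg]
    rw [← h3]
    refine Finset.sum_congr rfl fun j _ => ?_
    push_cast
    ring_nf
  have hcard : ((fibreIdx N S (t : UnitAddCircle)).card : ℤ) = g t := by
    set s := circleRep 0 (t : UnitAddCircle) with hs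
    have hst : ((s : ℝ) : UnitAddCircle) = t := coe_circleRep 0 _
    obtain ⟨m, hm⟩ : ∃ m : ℤ, t = s + m := by
      obtain ⟨m, hm⟩ := coe_eq_coe_iff_exists_int.1 hst.symm
      exact ⟨m, hm⟩
    have hgt : g t = g s := by
      rw [hm]
      simpa using (hper.int_mul m) s
    rw [hgt, hg]
    simp only [fibreIdx, Finset.card_filter, circleIndicator]
    push_cast
    refine Finset.sum_congr rfl fun j _ => ?_
    have : fibrePt N j (t : UnitAddCircle) = (((s + j) / N : ℝ) : UnitAddCircle) := by
      rw [fibrePt, branch, ← hs]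
      congr 1
      field_simp
      ring
    rw [this]
  change _ = if (n : ℤ) + 1 ≤ g t then 1 else 0
  rw [← hcard, circleIndicator]
  congr 1
  rw [mem_ofPred_eq, Int.add_one_le_iff]
  exact_mod_cast rfl

/-- Dirichlet gives k with kβ within 1/4 of an integer. If the error e is negative, multiply further
by m = ⌊1/(-e)⌋: then 1 + m e lies in [0, -e). -/
theorem exists_fract_mul_le (β : ℝ) : ∃ N : ℕ, 0 < N ∧ Int.fract (N * β) ≤ 1 / 4 := by
  obtain ⟨k, hk, -, hle⟩ := Real.exists_nat_abs_mul_sub_round_le β (n := 3) (by norm_num)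
  set e := (k : ℝ) * β - round ((k : ℝ) * β) with he
  have hle' : |e| ≤ 1 / 4 := by norm_num at hle; linarith
  rcases le_or_gt 0 e with h0 | h0
  · refine ⟨k, hk, ?_⟩
    rw [abs_of_nonneg h0] at hle'
    have : Int.fract ((k : ℝ) * β) = e := by
      rw [show (k : ℝ) * β = e + (round ((k : ℝ) * β) : ℤ) by rw [he]; ring, Int.fract_add_intCast,
        Int.fract_eq_self]
      exact ⟨h0, by linarith⟩
    linarith
  · rw [abs_of_neg h0] at hle'
    have hm1 : 1 ≤ 1 / (-e) := by rw [le_div_iff₀ (by linarith)]; linarith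
    have hm : 0 < ⌊1 / (-e)⌋₊ := Nat.floor_pos.2 hm1
    set m := ⌊1 / (-e)⌋₊
    have h1 : (m : ℝ) * (-e) ≤ 1 := by
      rw [← le_div_iff₀ (by linarith)]
      exact Nat.floor_le (by linarith)
    have h2 : 1 < ((m : ℝ) + 1) * (-e) := by
      rw [← div_lt_iff₀ (by linarith)]
      exact Nat.lt_floor_add_one _
    refine ⟨m * k, Nat.mul_pos hm hk, ?_⟩
    have : Int.fract (((m * k : ℕ) : ℝ) * β) = 1 + m * e := by
      rw [show ((m * k : ℕ) : ℝ) * β = (1 + m * e) + ((m * round ((k : ℝ) * β) - 1 : ℤ) : ℝ) by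
        rw [he]; push_cast; ring, Int.fract_add_intCast, Int.fract_eq_self]
      have hm' : (0 : ℝ) < m := by exact_mod_cast hm
      constructor <;> nlinarith
    rw [this]
    nlinarith

theorem floor_sub_floor_eq {x δ : ℝ} (h0 : 0 ≤ δ) (h1 : δ < 1) :
    ⌊x⌋ - ⌊x - δ⌋ = if Int.fract x < δ then 1 else 0 := by
  have hx := Int.floor_add_fract x
  have hf0 := Int.fract_nonneg x
  have hf1 := Int.fract_lt_one x
  split_ifs with h
  · have : ⌊x - δ⌋ = ⌊x⌋ - 1 := by
      rw [Int.floor_eq_iff]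
      push_cast
      constructor <;> linarith
    omega
  · have : ⌊x - δ⌋ = ⌊x⌋ := by
      rw [Int.floor_eq_iff]
      constructor <;> linarith
    omega

theorem exists_isRieszSpectrum_of_fold {N : ℕ} (hN : 0 < N) {S : Set UnitAddCircle}
    (hS : MeasurableSet S)
    (h : ∀ n : ℕ, ∃ Λ, IsRieszSpectrum Λ {y | n < (fibreIdx N S y).card}) :
    ∃ Λ, IsRieszSpectrum Λ S := by
  choose Λ hΛ using h
  exact ⟨_, IsRieszSpectrum.combine hN hS fun n _ => hΛ n⟩

/-- A suitable fold is a constant plus the indicator of an arc of length at most 1/4, so its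
superlevel sets are the circle, that arc and the empty set. -/
theorem exists_isRieszSpectrum_of_isFloorSum_one {S : Set UnitAddCircle}
    (h : IsFloorSum 1 (circleIndicator S)) : ∃ Λ, IsRieszSpectrum Λ S := by
  have hmeas := measurableSet_of_isFloorSum h
  obtain ⟨c, a, b, h⟩ := h
  obtain ⟨N, hN, hle⟩ := exists_fract_mul_le (b 0 - a 0)
  set δ := Int.fract (N * (b 0 - a 0)) with hδ
  set m := ⌊N * (b 0 - a 0)⌋
  have hδ0 : 0 ≤ δ := Int.fract_nonneg _
  have hfold : ∀ t, ∑ j ∈ Finset.range N, circleIndicator S ((t + j) / N) =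
      N * c + m + if Int.fract (t - N * a 0) < δ then 1 else 0 := by
    intro t
    rw [floorSum_fold hN h, Finset.sum_range_one, ← floor_sub_floor_eq hδ0 (by linarith),
      show t - N * b 0 = t - N * a 0 - δ - m by
        have := Int.floor_add_fract (N * (b 0 - a 0)); linarith, Int.floor_sub_intCast]
    ring
  refine exists_isRieszSpectrum_of_fold hN hmeas fun n => ?_
  have hmem : ∀ t : ℝ, (t : UnitAddCircle) ∈ {y | n < (fibreIdx N S y).card} ↔
      (n : ℤ) + 1 ≤ N * c + m + if Int.fract (t - N * a 0) < δ then 1 else 0 := by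
    intro t
    have h1 := circleIndicator_fibre hN S n t
    rw [hfold, circleIndicator] at h1
    constructor
    · intro h2
      by_contra h3
      rw [if_pos h2, if_neg h3] at h1
      exact one_ne_zero h1
    · intro h2
      by_contra h3
      rw [if_neg h3, if_pos h2] at h1
      exact zero_ne_one h1
  rcases lt_trichotomy ((n : ℤ) + 1) (N * c + m + 1) with hlt | heq | hgt
  · have : {y | n < (fibreIdx N S y).card} = univ := by
      refine eq_univ_of_forall fun y => ?_
      rw [← coe_circleRep 0 y, hmem]
      split_ifs <;> omega
    exact ⟨_, this ▸ isRieszSpectrum_univ⟩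
  · rcases hδ0.eq_or_lt with h0 | hpos
    · have : {y | n < (fibreIdx N S y).card} = ∅ := by
        refine eq_empty_of_forall_notMem fun y => ?_
        rw [← coe_circleRep 0 y, hmem, ← h0, if_neg (Int.fract_nonneg _).not_gt]
        omega
      exact ⟨_, this ▸ isRieszSpectrum_empty⟩
    · refine exists_isRieszSpectrum_arc hpos hle (p := N * a 0) fun t => ?_
      rw [hmem, heq]
      split_ifs with h1 <;> simp [h1]
  · have : {y | n < (fibreIdx N S y).card} = ∅ := by
      refine eq_empty_of_forall_notMem fun y => ?_
      rw [← coe_circleRep 0 y, hmem]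
      split_ifs <;> omega
    exact ⟨_, this ▸ isRieszSpectrum_empty⟩

theorem exists_isRieszSpectrum {L : ℕ} {S : Set UnitAddCircle}
    (h : IsFloorSum L (circleIndicator S)) : ∃ Λ, IsRieszSpectrum Λ S := by
  -- Padding by a trivial pair of jumps starts the induction at one pair; the reducing fold needs at
  -- least two.
  suffices H : ∀ (L : ℕ) (S : Set UnitAddCircle), IsFloorSum (L + 1) (circleIndicator S) →
      ∃ Λ, IsRieszSpectrum Λ S from H L S h.succ
  intro L
  induction L with
  | zero => exact fun S h => exists_isRieszSpectrum_of_isFloorSum_one h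
  | succ L ih =>
    intro S h
    obtain ⟨N, hN, hred⟩ := h.exists_reducing_fold (by omega)
    refine exists_isRieszSpectrum_of_fold hN (measurableSet_of_isFloorSum h) fun n => ih _ ?_
    rw [show circleIndicator {y | n < (fibreIdx N S y).card} = _ from
      funext (circleIndicator_fibre hN S n)]
    exact hred _

/-! ### Riesz bases from isomorphisms -/

/-- By polar decomposition, the image of a Hilbert basis under an isomorphism onto another Hilbert
space is a Riesz basis of that space. -/
theorem isRieszBasis_of_equiv {ι H K : Type*} [NormedAddCommGroup H] [InnerProductSpace ℂ H]
    [CompleteSpace H] [NormedAddCommGroup K] [InnerProductSpace ℂ K] [CompleteSpace K]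
    (b : HilbertBasis ι ℂ H) (Φ : H ≃L[ℂ] K) : IsRieszBasis fun i => Φ (b i) := by
  set F : H →L[ℂ] K := Φ.toContinuousLinearMap
  -- Write Φ = V E with E = √(Φ*Φ) invertible and V unitary. Then V b is an orthonormal basis of K,
  -- and V E V⁻¹ maps it to Φ b.
  set A : H →L[ℂ] H := (ContinuousLinearMap.adjoint F).comp F with hA
  have hA0 : 0 ≤ A :=
    (ContinuousLinearMap.nonneg_iff_isPositive A).2 (ContinuousLinearMap.isPositive_adjoint_comp_self F)
  set B : H →L[ℂ] H := CFC.sqrt A with hB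
  have hBB : B * B = A := CFC.sqrt_mul_sqrt_self A hA0
  have hBs : IsSelfAdjoint B := (CFC.sqrt_nonneg A).isSelfAdjoint
  have hnorm : ∀ v, ‖B v‖ = ‖Φ v‖ := by
    intro v
    have h1 : inner ℂ (B v) (B v) = inner ℂ (F v) (F v) := by
      have h2 : ContinuousLinearMap.adjoint B = B := hBs
      rw [← ContinuousLinearMap.adjoint_inner_right, h2, ← mul_apply_eq_comp, hBB, hA,
        ContinuousLinearMap.comp_apply, ContinuousLinearMap.adjoint_inner_right]
    rw [inner_self_eq_norm_sq_to_K, inner_self_eq_norm_sq_to_K] at h1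
    have h3 : ‖B v‖ ^ 2 = ‖F v‖ ^ 2 := by exact_mod_cast h1
    exact (sq_eq_sq₀ (norm_nonneg _) (norm_nonneg _)).1 h3
  have hAu : IsUnit A := by
    rw [ContinuousLinearMap.isUnit_iff_bijective]
    have hadj : Function.Bijective (ContinuousLinearMap.adjoint F) := by
      set G : K →L[ℂ] H := Φ.symm.toContinuousLinearMap
      have e1 : (ContinuousLinearMap.adjoint G).comp (ContinuousLinearMap.adjoint F) =
          ContinuousLinearMap.id ℂ K := by
        rw [← ContinuousLinearMap.adjoint_comp]
        have : F.comp G = ContinuousLinearMap.id ℂ K := by ext; simp [F, G]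
        rw [this, ContinuousLinearMap.adjoint_id]
      have e2 : (ContinuousLinearMap.adjoint F).comp (ContinuousLinearMap.adjoint G) =
          ContinuousLinearMap.id ℂ H := by
        rw [← ContinuousLinearMap.adjoint_comp]
        have : G.comp F = ContinuousLinearMap.id ℂ H := by ext; simp [F, G]
        rw [this, ContinuousLinearMap.adjoint_id]
      exact Function.bijective_iff_has_inverse.2 ⟨ContinuousLinearMap.adjoint G,
        fun x => DFunLike.congr_fun e1 x, fun x => DFunLike.congr_fun e2 x⟩
    exact hadj.comp Φ.bijective
  have hBu : IsUnit B := by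
    rw [← hBB] at hAu
    exact ((Commute.refl B).isUnit_mul_iff.1 hAu).1
  obtain ⟨u, hu⟩ := hBu
  set E : H ≃L[ℂ] H := ContinuousLinearEquiv.ofUnit u
  have hE : ∀ v, E v = B v := fun v => by rw [← hu]; rfl
  set V : H ≃ₗᵢ[ℂ] K :=
    { (E.symm.trans Φ).toLinearEquiv with
      norm_map' := fun v => by
        change ‖Φ (E.symm v)‖ = ‖v‖
        rw [← hnorm, ← hE, E.apply_symm_apply] }
  have hVE : ∀ v, V (E v) = Φ v := fun v => congrArg Φ (E.symm_apply_apply v)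
  refine ⟨HilbertBasis.ofRepr (V.symm.trans b.repr),
    (V.symm.toContinuousLinearEquiv.trans E).trans V.toContinuousLinearEquiv, fun i => ?_⟩
  classical
  have h1 : (HilbertBasis.ofRepr (V.symm.trans b.repr)) i = V (b i) := by
    rw [← HilbertBasis.repr_symm_single, ← b.repr_symm_single]
    rfl
  rw [h1]
  change Φ (b i) = V (E (V.symm (V (b i))))
  rw [V.symm_apply_apply, hVE]

/-! ### From the circle to the line -/

theorem IsRieszSpectrum.isExpRieszBasis {Λ : Set ℤ} {T : Set UnitAddCircle} {S : Set ℝ} {c P : ℝ}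
    (hP : 0 < P) (hΛ : IsRieszSpectrum Λ T) (hT : MeasurableSet T)
    (hS : ∀ t, t ∈ S ↔ t ∈ Ioc c (c + P) ∧ ((t / P : ℝ) : UnitAddCircle) ∈ T) :
    IsExpRieszBasis ((fun k : ℤ => 2 * Real.pi / P * (k : ℝ)) '' Λ) S := by
  set φ : ℝ → UnitAddCircle := fun t => ((t / P : ℝ) : UnitAddCircle) with hφdef
  have hφ : Measurable φ := AddCircle.measurable_mk'.comp (measurable_id.div_const P)
  have hSeq : S = Ioc c (c + P) ∩ φ ⁻¹' T := ext fun t => hS t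
  have hSm : MeasurableSet S := hSeq ▸ measurableSet_Ioc.inter (hφ hT)
  have hmap : Measure.map φ (volume.restrict S) ≤ ENNReal.ofReal P • haarAddCircle :=
    (Measure.map_mono (Measure.restrict_mono (fun t ht => ((hS t).1 ht).1) le_rfl) hφ).trans
      (map_scale_le hP)
  obtain ⟨Z, hZ⟩ := exists_compLp hφ ENNReal.ofReal_ne_top hmap
  have hae : ∀ Q : UnitAddCircle → Prop, (∀ᵐ t ∂volume.restrict S, Q (φ t)) ↔
      ∀ᵐ x ∂haarAddCircle, x ∈ T → Q x := by
    intro Q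
    rw [ae_restrict_iff' hSm, ae_circle_iff_Ioc (c / P),
      ← ae_affine_iff hP.ne' 0 (P := fun t => t ∈ S → Q (φ t))]
    refine eventually_congr (Eventually.of_forall fun s => ?_)
    have h1 : (0 + P * s) / P = s := by field_simp; ring
    have h2 : 0 + P * s ∈ Ioc c (c + P) ↔ s ∈ Ioc (c / P) (c / P + 1) := by
      rw [mem_Ioc, mem_Ioc, div_lt_iff₀ hP, show c / P + 1 = (c + P) / P by field_simp,
        le_div_iff₀ hP, zero_add, mul_comm]
    rw [hS, hφdef]
    simp only [h1, h2, and_imp]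
  have hZ0 : ∀ g, Z g = 0 ↔ ∀ᵐ x ∂haarAddCircle, x ∈ T → g x = 0 := by
    intro g
    rw [Lp.eq_zero_iff_ae_eq_zero, ← hae fun x => g x = 0]
    constructor
    · intro h
      filter_upwards [h, hZ g] with y h1 h2
      rw [← h2, h1]
      rfl
    · intro h
      filter_upwards [h, hZ g] with y h1 h2
      rw [h2, h1]
      rfl
  -- A preimage of F is its extension by zero, read on the fundamental domain (c/P, c/P + 1].
  have hsurj : Function.Surjective Z := by
    intro F
    have hF : MemLp (S.indicator F) 2 volume := (memLp_indicator_iff_restrict hSm).2 (Lp.memLp F)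
    have hF2 : MemLp (fun s => S.indicator F (P * s)) 2 volume := by
      have h1 : MemLp (S.indicator F) 2 (Measure.map (fun s => P * s) volume) := by
        rw [Real.map_volume_mul_left hP.ne']
        exact hF.smul_measure ENNReal.ofReal_ne_top
      exact h1.comp_of_map (measurable_const_mul P).aemeasurable
    have hG : MemLp (fun x => S.indicator F (P * circleRep (c / P) x)) 2 haarAddCircle := by
      have h1 : MemLp (fun s => S.indicator F (P * s)) 2
          (Measure.map (circleRep (c / P)) haarAddCircle) := by
        rw [map_circleRep]
        exact hF2.restrict _
      exact h1.comp_of_map (measurableEmbedding_circleRep _).measurable.aemeasurable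
    refine ⟨hG.toLp, Lp.ext ?_⟩
    have h2 := (hae fun x => (hG.toLp : Lp ℂ 2 haarAddCircle) x =
      S.indicator F (P * circleRep (c / P) x)).2 (hG.coeFn_toLp.mono fun x hx _ => hx)
    filter_upwards [hZ hG.toLp, h2, ae_restrict_mem hSm] with t h3 h4 h5
    have h6 : t / P ∈ Ioc (c / P) (c / P + 1) := by
      have := ((hS t).1 h5).1
      rw [mem_Ioc, div_lt_div_iff_of_pos_right hP, show c / P + 1 = (c + P) / P by field_simp,
        div_le_div_iff_of_pos_right hP]
      exact this
    rw [h3, h4, hφdef, circleRep_coe h6, mul_div_cancel₀ _ hP.ne', indicator_of_mem h5]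
  have hbij := hΛ.bijective Z hZ0 hsurj
  set Φ := ContinuousLinearEquiv.ofBijective (Z.comp (spectralSubspace Λ).subtypeL)
    (LinearMap.ker_eq_bot.2 hbij.1) (LinearMap.range_eq_top.2 hbij.2)
  set Λ' : Set ℝ := (fun k : ℤ => 2 * Real.pi / P * (k : ℝ)) '' Λ
  have hk : ∀ l : Λ', ∃ k : ℤ, k ∈ Λ ∧ 2 * Real.pi / P * (k : ℝ) = l := fun l => l.2
  choose e heΛ he using hk
  have hpos : 2 * Real.pi / P ≠ 0 := by positivity
  have hinj : Function.Injective e := fun l l' hll => Subtype.ext (by rw [← he, ← he, hll])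
  have hrange : range e = Λ := by
    refine Subset.antisymm (range_subset_iff.2 heΛ) fun k hk => ⟨⟨_, k, hk, rfl⟩, ?_⟩
    have := mul_left_cancel₀ hpos (he ⟨_, k, hk, rfl⟩)
    exact_mod_cast this
  obtain ⟨b, hb⟩ := exists_hilbertBasis_spectralSubspace e hinj hrange (fun _ => 1) (by simp)
  refine ⟨fun l => Φ (b l), fun l => ?_, isRieszBasis_of_equiv b Φ⟩
  have h1 : Φ (b l) = Z (fourierBasis (e l)) := by
    change Z (b l : Lp ℂ 2 haarAddCircle) = _
    rw [hb, one_smul]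
  dsimp only
  rw [h1]
  have h2 := (hae fun x => fourierBasis (T := 1) (e l) x = fourier (e l) x).2
    ((fourierBasis_coeFn (e l)).mono fun x hx _ => hx)
  filter_upwards [hZ (fourierBasis (e l)), h2] with t h3 h4
  rw [h3, h4, hφdef, fourier_coe_eq_expTwoPi, expTwoPi, ← he l]
  congr 1
  push_cast
  field_simp

/-! ### Finite unions of intervals -/

/-- Arcs closed on the left match the right-continuous floors at every t, endpoints included. -/
theorem circleIndicator_arc {a b : ℝ} (hab : a ≤ b) (hb : b ≤ a + 1) (t : ℝ) :
    circleIndicator ((fun s : ℝ => (s : UnitAddCircle)) '' Ico a b) t = ⌊t - a⌋ - ⌊t - b⌋ := by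
  have h1 := Int.floor_le (t - a)
  have h2 := Int.lt_floor_add_one (t - a)
  have hiff : (t : UnitAddCircle) ∈ (fun s : ℝ => (s : UnitAddCircle)) '' Ico a b ↔
      t - ⌊t - a⌋ < b := by
    constructor
    · rintro ⟨s, hs, hst⟩
      obtain ⟨m, hm⟩ := coe_eq_coe_iff_exists_int.1 hst
      have : ⌊t - a⌋ = -m := by
        rw [Int.floor_eq_iff]
        push_cast
        constructor <;> linarith [hs.1, hs.2]
      rw [this]
      push_cast
      linarith [hs.2]
    · intro h
      refine ⟨t - ⌊t - a⌋, ⟨by linarith, h⟩, coe_eq_coe_iff_exists_int.2 ⟨-⌊t - a⌋, ?_⟩⟩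
      push_cast
      ring
  rw [circleIndicator]
  split_ifs with h
  · have h3 := hiff.1 h
    have : ⌊t - b⌋ = ⌊t - a⌋ - 1 := by
      rw [Int.floor_eq_iff]
      push_cast
      constructor <;> linarith
    omega
  · have h3 := not_lt.1 (fun h' => h (hiff.2 h'))
    have : ⌊t - b⌋ = ⌊t - a⌋ := by
      rw [Int.floor_eq_iff]
      constructor <;> linarith
    omega

theorem exists_isFloorSum_biUnion {ι : Type*} (s : Finset ι) (a b : ι → ℝ)
    (hab : ∀ i, a i ≤ b i) (hb : ∀ i, b i ≤ a i + 1) :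
    ∃ L, IsFloorSum L
      (circleIndicator (⋃ i ∈ s, (fun t : ℝ => (t : UnitAddCircle)) '' Ico (a i) (b i))) := by
  classical
  induction s using Finset.induction_on with
  | empty => exact ⟨0, 0, 0, 0, fun t => by simp [circleIndicator]⟩
  | insert i s _ ih =>
    obtain ⟨L, hL⟩ := ih
    have h1 : IsFloorSum 1
        (circleIndicator ((fun t : ℝ => (t : UnitAddCircle)) '' Ico (a i) (b i))) :=
      ⟨0, fun _ => a i, fun _ => b i, fun t => by simp [circleIndicator_arc (hab i) (hb i)]⟩
    refine ⟨1 + L, ?_⟩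
    -- The indicator of a union is the superlevel set at 1 of the sum of indicators.
    convert (h1.add hL).superlevel_same 1 using 2 with t
    rw [Finset.set_biUnion_insert]
    simp only [circleIndicator, mem_union]
    split_ifs <;> simp_all

theorem exists_Ioo_Icc_of_ordConnected {J : Set ℝ} (hJ : J.OrdConnected) {u v : ℝ} (huv : u ≤ v)
    (hJs : J ⊆ Icc u v) :
    ∃ a b, u ≤ a ∧ a ≤ b ∧ b ≤ v ∧ Ioo a b ⊆ J ∧ J ⊆ Icc a b := by
  rcases J.eq_empty_or_nonempty with rfl | hne
  · exact ⟨u, u, le_rfl, le_rfl, huv, by simp, by simp⟩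
  · have hbb : BddBelow J := ⟨u, fun x hx => (hJs hx).1⟩
    have hba : BddAbove J := ⟨v, fun x hx => (hJs hx).2⟩
    refine ⟨sInf J, sSup J, le_csInf hne fun x hx => (hJs hx).1, Real.sInf_le_sSup J hbb hba,
      csSup_le hne fun x hx => (hJs hx).2, fun x hx => ?_,
      fun x hx => ⟨csInf_le hbb hx, le_csSup hba hx⟩⟩
    obtain ⟨y, hy, hyx⟩ := (csInf_lt_iff hbb hne).1 hx.1
    obtain ⟨z, hz, hxz⟩ := (lt_csSup_iff hba hne).1 hx.2
    exact hJ.out hy hz ⟨hyx.le, hxz.le⟩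

theorem exists_isExpRieszBasis {S : Set ℝ} (hS : IsFiniteUnionOfIntervals S) {c P : ℝ} (hP : 0 < P)
    (hSc : S ⊆ Icc c (c + P)) :
    ∃ Λ : Set ℤ, IsExpRieszBasis ((fun k : ℤ => 2 * Real.pi / P * (k : ℝ)) '' Λ) S := by
  obtain ⟨n, J, hJ, rfl⟩ := hS
  choose a b hca hab hbc hIoo hIcc using fun i => exists_Ioo_Icc_of_ordConnected (hJ i).1
    (by linarith : c ≤ c + P) ((subset_iUnion J i).trans hSc)
  obtain ⟨L, hL⟩ := exists_isFloorSum_biUnion Finset.univ (fun i => a i / P) (fun i => b i / P)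
    (fun i => by have := hab i; gcongr) (fun i => by
      rw [show a i / P + 1 = (a i + P) / P by field_simp]
      have := hca i
      have := hbc i
      exact (div_le_div_iff_of_pos_right hP).2 (by linarith))
  set T := ⋃ i ∈ (Finset.univ : Finset (Fin n)),
    (fun t : ℝ => (t : UnitAddCircle)) '' Ico (a i / P) (b i / P) with hT
  obtain ⟨Λ, hΛ⟩ := exists_isRieszSpectrum hL
  have hbasis := hΛ.isExpRieszBasis hP (measurableSet_of_isFloorSum hL)
    (S := {t | t ∈ Ioc c (c + P) ∧ ((t / P : ℝ) : UnitAddCircle) ∈ T}) (c := c) fun t => Iff.rfl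
  refine ⟨Λ, ?_⟩
  -- The intervals and the half-open arcs can differ only at c, c + P and the endpoints a i, b i, a
  -- null set.
  have hres : volume.restrict (⋃ i, J i) =
      volume.restrict {t | t ∈ Ioc c (c + P) ∧ ((t / P : ℝ) : UnitAddCircle) ∈ T} := by
    refine Measure.restrict_congr_set ?_
    have hne : ∀ᵐ t : ℝ, t ≠ c + P ∧ t ≠ c ∧ ∀ i, t ≠ a i ∧ t ≠ b i := by
      refine Eventually.and ?_ (Eventually.and ?_ (ae_all_iff.2 fun i => Eventually.and ?_ ?_)) <;>
        simp [ae_iff]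
    refine Filter.eventuallyEq_set.2 ?_
    filter_upwards [hne] with t ht
    rw [mem_iUnion, hT]
    simp only [Finset.mem_univ, iUnion_true, mem_iUnion]
    constructor
    · rintro ⟨i, hi⟩
      have h1 := hIcc i hi
      have h2 := hSc (mem_iUnion.2 ⟨i, hi⟩)
      refine ⟨⟨lt_of_le_of_ne h2.1 ht.2.1.symm, h2.2⟩, i, t / P, ⟨?_, ?_⟩, rfl⟩
      · exact (div_le_div_iff_of_pos_right hP).2 h1.1
      · exact (div_lt_div_iff_of_pos_right hP).2 (lt_of_le_of_ne h1.2 (ht.2.2 i).2)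
    · rintro ⟨h1, i, s, hs, hst⟩
      obtain ⟨m, hm⟩ := coe_eq_coe_iff_exists_int.1 hst
      have h3 : a i ≤ P * s := by
        have := hs.1
        rwa [div_le_iff₀ hP, mul_comm] at this
      have h4 : P * s < b i := by
        have := hs.2
        rwa [lt_div_iff₀ hP, mul_comm] at this
      have h5 : P * s = t + P * m := by
        rw [hm, mul_add, mul_div_cancel₀ _ hP.ne']
      have h6 : t < c + P := lt_of_le_of_ne h1.2 ht.1
      -- As c < t < c + P, a shift with m ≠ 0 would carry P s out of [c, c + P], which contains [a
      -- i, b i).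
      have hm1 : (-1 : ℝ) < m := by
        by_contra hcon
        have := hca i
        nlinarith
      have hm2 : (m : ℝ) < 1 := by
        by_contra hcon
        have := hbc i
        nlinarith [h1.1]
      have hm0 : m = 0 := by
        have h7 : (-1 : ℤ) < m := by exact_mod_cast hm1
        have h8 : m < 1 := by exact_mod_cast hm2
        omega
      rw [hm0, Int.cast_zero, mul_zero, add_zero] at h5
      refine ⟨i, hIoo i ⟨lt_of_le_of_ne (h5 ▸ h3) (ht.2.2 i).1.symm, h5 ▸ h4⟩⟩
  unfold IsExpRieszBasis
  rw [hres]
  exact hbasis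

theorem mainTheorem1 (S : Set ℝ) (hS : IsFiniteUnionOfIntervals S) :
    (∃ Λ : Set ℝ, IsExpRieszBasis Λ S) ∧
    (S ⊆ Set.Icc 0 (2 * Real.pi) →
      ∃ Λ : Set ℝ, Λ ⊆ Set.range ((↑) : ℤ → ℝ) ∧ IsExpRieszBasis Λ S) := by
  constructor
  · have hbdd : Bornology.IsBounded S := by
      obtain ⟨n, J, hJ, rfl⟩ := hS
      exact Bornology.isBounded_iUnion.2 fun i => (hJ i).2
    obtain ⟨R, hR⟩ := hbdd.subset_closedBall 0
    rw [Real.closedBall_eq_Icc] at hR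
    -- Taking |R| + 1 keeps the period positive for every R, which may be negative if S is empty.
    obtain ⟨Λ, hΛ⟩ := exists_isExpRieszBasis hS (c := -(|R| + 1)) (P := 2 * (|R| + 1))
      (by positivity) fun t ht => ⟨by linarith [(hR ht).1, le_abs_self R],
        by linarith [(hR ht).2, le_abs_self R]⟩
    exact ⟨_, hΛ⟩
  · intro hS2
    obtain ⟨Λ, hΛ⟩ := exists_isExpRieszBasis hS (c := 0) (P := 2 * Real.pi) Real.two_pi_pos
      (by rwa [zero_add])
    refine ⟨_, ?_, hΛ⟩
    rintro _ ⟨k, _, rfl⟩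
    exact ⟨k, by dsimp only; rw [div_self Real.two_pi_pos.ne', one_mul]⟩
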